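/- **Setting.** Fix $n\in\{1,2,\dots\}\cup\{\infty\}$. Manifolds are finite-dimensional, of class $C^n$, without boundary; no separation or countability axiom is assumed. *Cartesian closure.* Let $\mathcal F$ be a category of topological spaces and continuous maps that contains constant maps and open subspaces with their inclusions, and is closed under restriction to open subspaces and under gluing of maps along open covers. An object of $\overline{\mathcal F}$ is a set $X$ with, for each $H\in\mathcal F$, a set of maps $H\to X$ ("figures of type $H$") containing the constants, stable under precomposition with arrows of $\mathcal F$, and local on $H$. Arrows are the maps taking figures to figures. Each $K\in\mathcal F$ gives $\bar K\in\overline{\mathcal F}$ whose figures are the $\mathcal F$-arrows into $K$. Products have componentwise figures. The exponential $Y^X$ is the set of arrows $X\to Y$, where $d:H\to Y^X$ is a figure iff $(h,x)\mapsto d(h)(x)$ is an arrow $\bar H\times X\to Y$. Each space carries the final topology of its figures. *$C^n$ spaces.* They are the objects of $\overline{\mathcal F}$ for $\mathcal F$ the category of open subsets of the spaces $\mathbb R^m$ with $C^n$ maps. A manifold $M$ is a $C^n$ space whose figures are the $C^n$ maps $H\to M$. An observable of a $C^n$ space $X$ is an arrow $\varphi:U\to\bar K$, with $U\subseteq X$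 open with the induced figures and $K$ open in some $\mathbb R^k$. A path $x:\mathbb R\to X$ continuous at $0$ is nilpotent if for every observable $\varphi$ with $x_0\in U$ there is $j\in\mathbb N$ with $\|\varphi(x_t)-\varphi(x_0)\|^j=o(t)$ as $t\to0$. Two nilpotent paths $x,y$ are equivalent if for every observable $\varphi:U\to\bar K$ one has $x_0\in U\Leftrightarrow y_0\in U$ and, in this case, $\varphi(x_t)=\varphi(y_t)+o(t)$. Write ${}^\bullet X$ for the set of classes, and ${}^\bullet f[x]=[f\circ x]$ for an arrow $f$. *Extended spaces.* They are the objects of $\overline{\mathcal F}$ for the following $\mathcal F$. Its objects are the subsets $S\subseteq{}^\bullet(\mathbb R^s)$, $s\in\mathbb N$, with the topology generated by the sets ${}^\bullet U\cap S$, $U\subseteq\mathbb R^s$ open. Its arrows $f:S\to T\subseteq{}^\bullet(\mathbb R^t)$ are the maps that near each point of $S$ have the form $f(x)={}^\bullet g\langle p,x\rangle$ for all $x\in{}^\bullet V\cap S$, with $p\in{}^\bullet U\subseteq{}^\bullet(\mathbb R^m)$, $U\subseteq\mathbb R^m$ and $V\subseteq\mathbb R^s$ open, $g\in C^n(U\times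 V,\mathbb R^t)$, and $\langle[a],[b]\rangle=[(a,b)]$. For $Z\subseteq{}^\bullet X$, the extended space induced on $Z$ by $X$ has as figures the maps that are locally the composite of an arrow of $\mathcal F$ with a map $T\to Z$ that is either constant or ${}^\bullet h|_T$, for a figure $h:V\to X$ with $T\subseteq{}^\bullet V$. In this way ${}^\bullet X$ is an extended space, and so is $D=\{h\in{}^\bullet\mathbb R : h(t)=O(t)\}$ (induced by $\mathbb R$). *Infinitesimal linearity.* An extended space $X$ is infinitesimally linear if for every integer $k>1$, every $x\in X$ and all arrows $t_1,\dots,t_k:D\to X$ with $t_i(0)=x$, there is exactly one arrow $p:D^k\to X$ with $$p(\underbrace{0,\dots,0}_{i-1},h,0,\dots,0)=t_i(h)\qquad\text{for all } i=1,\dots,k \text{ and all } h\in D .$$ **Theorem.** For every manifold $M$, the extended space ${}^\bullet M$ is infinitesimally linear. If $M_1,\dots,M_s$ ($s\ge2$) are manifolds, then the iterated exponential and the exponential of the product are isomorphic, $$\Bigl(\cdots\bigl({}^\bullet M_1^{\ {}^\bullet M_2}\bigr)^{{}^\bullet M_3}\cdots\Bigr)^{{}^\bullet M_s}\;\cong\;{}^\bullet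 M_1^{\ {}^\bullet(M_2\times\cdots\times M_s)},$$ by an isomorphism of extended spaces sending $F$ to the map $z\mapsto F(m_s)\cdots(m_3)(m_2)$, where $m_i\in{}^\bullet M_i$ are the projections of $z$; and both sides are infinitesimally linear. -/

import Mathlib

open Set Filter Topology Asymptotics
open scoped Manifold ContDiff

universe u v

namespace IDG

/-! ## Types of figures and the cartesian closure -/

/-- A category of types of figures: a subcategory of `Top` that contains the constant maps and the
open subspaces of its objects with their inclusions, is closed under restriction of maps to open
subspaces, and has the sheaf property. `carrier H` is the support set `|H|`, `IsMor f` says that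
`f` is an arrow, `restr H U` is the open subspace `(U ≺ H)` and `incl H U` its inclusion. -/
structure FigCat where
  Obj : Type
  carrier : Obj → Type
  top : ∀ H, TopologicalSpace (carrier H)
  IsMor : ∀ {H K : Obj}, (carrier H → carrier K) → Prop
  restr : ∀ H : Obj, TopologicalSpace.Opens (carrier H) → Obj
  incl : ∀ (H : Obj) (U : TopologicalSpace.Opens (carrier H)), carrier (restr H U) → carrier H
  incl_isOpenEmbedding : ∀ H U, IsOpenEmbedding (incl H U)
  range_incl : ∀ H U, range (incl H U) = (U : Set (carrier H))
  continuous_of_isMor : ∀ {H K : Obj} {f : carrier H → carrier K}, IsMor f → Continuous f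
  isMor_id : ∀ H : Obj, IsMor (id : carrier H → carrier H)
  isMor_comp : ∀ {H J K : Obj} {g : carrier J → carrier K} {f : carrier H → carrier J},
    IsMor g → IsMor f → IsMor (g ∘ f)
  isMor_const : ∀ {H K : Obj} (k : carrier K), IsMor (fun _ : carrier H => k)
  isMor_incl : ∀ H U, IsMor (incl H U)
  isMor_lift : ∀ {H K : Obj} {V : TopologicalSpace.Opens (carrier K)}
    {f : carrier H → carrier (restr K V)}, IsMor (incl K V ∘ f) → IsMor f
  isMor_sheaf : ∀ {H K : Obj} {f : carrier H → carrier K},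
    (∀ h, ∃ U : TopologicalSpace.Opens (carrier H), h ∈ U ∧ IsMor (f ∘ incl H U)) → IsMor f

attribute [instance] FigCat.top

/-- Objects of the cartesian closure of `F`: a set with a family of figures, closed under
reparametrization, containing the constant maps, and of local character. -/
structure Space (F : FigCat) where
  carrier : Type u
  fig : ∀ H : F.Obj, (F.carrier H → carrier) → Prop
  fig_comp : ∀ {J H : F.Obj} {f : F.carrier J → F.carrier H} {d : F.carrier H → carrier},
    F.IsMor f → fig H d → fig J (d ∘ f)
  fig_const : ∀ (H : F.Obj) (x : carrier), fig H (fun _ => x)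
  fig_sheaf : ∀ (H : F.Obj) (d : F.carrier H → carrier),
    (∀ h, ∃ U : TopologicalSpace.Opens (F.carrier H), h ∈ U ∧ fig (F.restr H U) (d ∘ F.incl H U)) →
      fig H d

variable {F : FigCat}

/-- Arrows of the cartesian closure: maps that take figures to figures. -/
def Space.IsHom (X Y : Space F) (f : X.carrier → Y.carrier) : Prop :=
  ∀ (H : F.Obj) (d : F.carrier H → X.carrier), X.fig H d → Y.fig H (f ∘ d)

/-- The set of arrows `X → Y`. -/
def Space.Hom (X Y : Space F) : Type _ := {f : X.carrier → Y.carrier // X.IsHom Y f}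

instance (X Y : Space F) : CoeFun (X.Hom Y) (fun _ => X.carrier → Y.carrier) := ⟨Subtype.val⟩

/-- Composition of arrows. -/
def Space.Hom.comp {X Y Z : Space F} (g : Y.Hom Z) (f : X.Hom Y) : X.Hom Z :=
  ⟨fun x => g (f x), fun H d hd => g.2 H _ (f.2 H d hd)⟩

/-- Isomorphisms of the cartesian closure. -/
structure Space.Iso (X Y : Space F) where
  hom : X.Hom Y
  inv : Y.Hom X
  hom_inv : ∀ y, hom (inv y) = y
  inv_hom : ∀ x, inv (hom x) = x

/-- The final topology with respect to all figures. -/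
@[reducible] def Space.topology (X : Space F) : TopologicalSpace X.carrier where
  IsOpen U := ∀ (H : F.Obj) (d : F.carrier H → X.carrier), X.fig H d → IsOpen (d ⁻¹' U)
  isOpen_univ := fun _ _ _ => isOpen_univ
  isOpen_inter := fun _ _ hU hV H d hd => (hU H d hd).inter (hV H d hd)
  isOpen_sUnion := fun S hS H d hd => by
    rw [preimage_sUnion]
    exact isOpen_biUnion fun U hU => hS U hU H d hd

/-- The space `K̄` of an object `K` of `F`: its figures are the arrows of `F` into `K`. -/
def Space.bar (K : F.Obj) : Space F where
  carrier := F.carrier K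
  fig _ d := F.IsMor d
  fig_comp hf hd := F.isMor_comp hd hf
  fig_const _ x := F.isMor_const x
  fig_sheaf _ _ h := F.isMor_sheaf h

/-- The subspace `(S ≺ X)`. -/
def Space.sub (X : Space F) (S : Set X.carrier) : Space F where
  carrier := S
  fig H d := X.fig H (fun h => (d h : X.carrier))
  fig_comp hf hd := X.fig_comp hf hd
  fig_const H x := X.fig_const H x
  fig_sheaf H _ h := X.fig_sheaf H _ h

/-- The product of two spaces. -/
def Space.prod (X : Space.{u} F) (Y : Space F) : Space F where
  carrier := X.carrier × Y.carrier
  fig H d := X.fig H (fun h => (d h).1) ∧ Y.fig H (fun h => (d h).2)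
  fig_comp hf hd := ⟨X.fig_comp hf hd.1, Y.fig_comp hf hd.2⟩
  fig_const H x := ⟨X.fig_const H x.1, Y.fig_const H x.2⟩
  fig_sheaf H _ h := ⟨X.fig_sheaf H _ fun x => let ⟨U, hx, hU⟩ := h x; ⟨U, hx, hU.1⟩,
    Y.fig_sheaf H _ fun x => let ⟨U, hx, hU⟩ := h x; ⟨U, hx, hU.2⟩⟩

/-- The power `X^k` (a product of `k` copies of `X`). -/
def Space.pow (X : Space F) (k : ℕ) : Space F where
  carrier := Fin k → X.carrier
  fig H d := ∀ i, X.fig H (fun h => d h i)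
  fig_comp hf hd i := X.fig_comp hf (hd i)
  fig_const H x i := X.fig_const H (x i)
  fig_sheaf H _ h i := X.fig_sheaf H _ fun x => let ⟨U, hx, hU⟩ := h x; ⟨U, hx, hU i⟩

/-- The exponential object `Y^X`: the set of arrows `X → Y`; a map `d` into it is a figure of
type `H` iff `(h, x) ↦ d(h)(x)` is an arrow `H̄ × X → Y`. -/
def Space.exp (X Y : Space F) : Space F where
  carrier := X.Hom Y
  fig H d := ((Space.bar H).prod X).IsHom Y (fun z => d z.1 z.2)
  fig_comp {J H f d} hf hd K e he :=
    hd K (fun k => (f (e k).1, (e k).2)) ⟨F.isMor_comp hf he.1, he.2⟩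
  fig_const H x K e he := x.2 K _ he.2
  fig_sheaf H d h K e he := by
    refine Y.fig_sheaf K _ fun k => ?_
    obtain ⟨U, hU, hd⟩ := h (e k).1
    let e₁ : F.carrier K → F.carrier H := fun k => (e k).1
    have he₁ : F.IsMor e₁ := he.1
    let V : TopologicalSpace.Opens (F.carrier K) :=
      ⟨e₁ ⁻¹' U, U.2.preimage (F.continuous_of_isMor he₁)⟩
    refine ⟨V, hU, ?_⟩
    have hmem : ∀ x : F.carrier (F.restr K V), e₁ (F.incl K V x) ∈ range (F.incl H U) := by
      intro x
      have : F.incl K V x ∈ (V : Set (F.carrier K)) := by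
        rw [← F.range_incl K V]; exact mem_range_self x
      rw [F.range_incl]
      exact this
    choose φ hφ using hmem
    have hφm : F.IsMor φ := by
      apply F.isMor_lift
      have : F.incl H U ∘ φ = e₁ ∘ F.incl K V := funext hφ
      rw [this]
      exact F.isMor_comp he₁ (F.isMor_incl K V)
    have := hd (F.restr K V) (fun x => (φ x, (e (F.incl K V x)).2))
      ⟨hφm, X.fig_comp (F.isMor_incl K V) he.2⟩
    refine (congrArg (Y.fig _) (funext fun x => ?_)).mp this
    exact congrArg (fun y => (d y) (e (F.incl K V x)).2) (hφ x)

/-- The space generated on a set `X` by a family `D₀` of figures that contains the constant maps: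
its figures are the maps that locally are a map of `D₀` composed with an arrow of `F`. -/
def Space.gen (X : Type u) (D₀ : ∀ K : F.Obj, Set (F.carrier K → X))
    (hD₀ : ∀ K x, (fun _ => x) ∈ D₀ K) : Space F where
  carrier := X
  fig H δ := ∀ h, ∃ U : TopologicalSpace.Opens (F.carrier H), h ∈ U ∧ ∃ K, ∃ d ∈ D₀ K,
    ∃ f : F.carrier (F.restr H U) → F.carrier K, F.IsMor f ∧ δ ∘ F.incl H U = d ∘ f
  fig_comp {J H f δ} hf hδ j := by
    obtain ⟨U, hU, K, d, hd, g, hg, hgd⟩ := hδ (f j)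
    let V : TopologicalSpace.Opens (F.carrier J) :=
      ⟨f ⁻¹' U, U.2.preimage (F.continuous_of_isMor hf)⟩
    have hmem : ∀ x : F.carrier (F.restr J V), f (F.incl J V x) ∈ range (F.incl H U) := by
      intro x
      have : F.incl J V x ∈ (V : Set (F.carrier J)) := by
        rw [← F.range_incl J V]; exact mem_range_self x
      rw [F.range_incl]
      exact this
    choose φ hφ using hmem
    have hφm : F.IsMor φ := by
      apply F.isMor_lift
      have : F.incl H U ∘ φ = f ∘ F.incl J V := funext hφ
      rw [this]
      exact F.isMor_comp hf (F.isMor_incl J V)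
    refine ⟨V, hU, K, d, hd, g ∘ φ, F.isMor_comp hg hφm, funext fun x => ?_⟩
    have := congrFun hgd (φ x)
    simpa [hφ] using this
  fig_const H x h := ⟨⊤, trivial, H, _, hD₀ H x, F.incl H ⊤, F.isMor_incl H ⊤, rfl⟩
  fig_sheaf H δ hδ h := by
    obtain ⟨U, hU, hδU⟩ := hδ h
    obtain ⟨h', rfl⟩ : h ∈ range (F.incl H U) := by rw [F.range_incl]; exact hU
    obtain ⟨U', hU', K, d, hd, f, hf, hfd⟩ := hδU h'
    let V : TopologicalSpace.Opens (F.carrier H) :=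
      ⟨F.incl H U '' U', (F.incl_isOpenEmbedding H U).isOpenMap _ U'.2⟩
    have hmem : ∀ x : F.carrier (F.restr H V),
        ∃ y : F.carrier (F.restr (F.restr H U) U'), F.incl H U (F.incl _ U' y) = F.incl H V x := by
      intro x
      have : F.incl H V x ∈ (V : Set (F.carrier H)) := by
        rw [← F.range_incl H V]; exact mem_range_self x
      obtain ⟨y, hy, hyx⟩ := this
      have hy' : y ∈ range (F.incl _ U') := by rw [F.range_incl]; exact hy
      obtain ⟨z, rfl⟩ := hy'
      exact ⟨z, hyx⟩
    choose φ hφ using hmem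
    have hφm : F.IsMor φ := by
      apply F.isMor_lift
      apply F.isMor_lift
      have : F.incl H U ∘ (F.incl _ U' ∘ φ) = F.incl H V := funext hφ
      rw [this]
      exact F.isMor_incl H V
    refine ⟨V, ⟨h', hU', rfl⟩, K, d, hd, f ∘ φ, F.isMor_comp hf hφm, funext fun x => ?_⟩
    have := congrFun hfd (φ x)
    simpa [hφ] using this

/-! ## The category `Cⁿ` -/

lemma contMDiffAt_of_comp_incl {n : ℕ∞} {E M : Type*} [NormedAddCommGroup E] [NormedSpace ℝ E]
    [TopologicalSpace M] [ChartedSpace E M] {m : ℕ} {W W' : TopologicalSpace.Opens (Fin m → ℝ)}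
    {d : W → M} {i : W' → W} (hi : ∀ x, (i x : Fin m → ℝ) = x) {x : W'}
    (h : ContMDiffAt 𝓘(ℝ, Fin m → ℝ) 𝓘(ℝ, E) n (d ∘ i) x) :
    ContMDiffAt 𝓘(ℝ, Fin m → ℝ) 𝓘(ℝ, E) n d (i x) := by
  let g : (Fin m → ℝ) → M := Function.extend Subtype.val d (fun _ => d (i x))
  have hg : ∀ y : W, g y = d y := fun y => Subtype.val_injective.extend_apply d _ y
  have h1 : (fun y : W => g y) = d := funext hg
  have h2 : (fun y : W' => g y) = d ∘ i := funext fun y => by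
    rw [← hi y]; exact hg (i y)
  rw [← h2, contMDiffAt_subtype_iff] at h
  rw [← h1, contMDiffAt_subtype_iff, hi]
  exact h

lemma contMDiff_subtypeVal_comp_iff {n : ℕ∞} {m k : ℕ} {W : TopologicalSpace.Opens (Fin m → ℝ)}
    {K : TopologicalSpace.Opens (Fin k → ℝ)} {f : W → K} :
    ContMDiff 𝓘(ℝ, Fin m → ℝ) 𝓘(ℝ, Fin k → ℝ) n (fun x => (f x : Fin k → ℝ)) ↔
      ContMDiff 𝓘(ℝ, Fin m → ℝ) 𝓘(ℝ, Fin k → ℝ) n f :=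
  forall_congr' fun x => ChartedSpace.liftPropWithinAt_subtypeVal_comp_iff f univ x

/-- The open subset of `ℝᵐ` given by an open subset of an open subset of `ℝᵐ`. -/
def openImage {m : ℕ} (W : TopologicalSpace.Opens (Fin m → ℝ)) (U : TopologicalSpace.Opens W) :
    TopologicalSpace.Opens (Fin m → ℝ) :=
  ⟨Subtype.val '' (U : Set W), W.2.isOpenMap_subtype_val _ U.2⟩

/-- The inclusion of `openImage W U` in `W`. -/
def openImageIncl {m : ℕ} (W : TopologicalSpace.Opens (Fin m → ℝ))
    (U : TopologicalSpace.Opens W) (x : openImage W U) : W :=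
  ⟨x, by obtain ⟨y, _, hy⟩ := x.2; rw [← hy]; exact y.2⟩

/-- The open subsets of the spaces `ℝᵐ`, `m ∈ ℕ`. -/
abbrev ORObj := Σ m : ℕ, TopologicalSpace.Opens (Fin m → ℝ)

/-- The category with objects the open subsets of the spaces `ℝᵐ`, `m ∈ ℕ`, and arrows the maps
of class `Cⁿ`. -/
def OR (n : ℕ∞) : FigCat where
  Obj := ORObj
  carrier H := H.2
  top _ := inferInstance
  IsMor {H K} f := ContMDiff 𝓘(ℝ, Fin H.1 → ℝ) 𝓘(ℝ, Fin K.1 → ℝ) n f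
  restr H U := ⟨H.1, openImage H.2 U⟩
  incl H U := openImageIncl H.2 U
  incl_isOpenEmbedding H U :=
    .of_comp _ H.2.2.isOpenEmbedding_subtypeVal (openImage H.2 U).2.isOpenEmbedding_subtypeVal
  range_incl H U := by
    ext x
    constructor
    · rintro ⟨⟨_, y, hy, rfl⟩, rfl⟩
      exact hy
    · intro hx
      exact ⟨⟨x, x, hx, rfl⟩, rfl⟩
  continuous_of_isMor h := h.continuous
  isMor_id _ := contMDiff_id
  isMor_comp hg hf := hg.comp hf
  isMor_const _ := contMDiff_const
  isMor_incl H U := contMDiff_subtypeVal_comp_iff.1 contMDiff_subtype_val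
  isMor_lift {H K V f} h :=
    contMDiff_subtypeVal_comp_iff.1 (contMDiff_subtypeVal_comp_iff.2 h :)
  isMor_sheaf {H K f} h x := by
    obtain ⟨U, hx, hU⟩ := h x
    exact contMDiffAt_of_comp_incl (i := openImageIncl H.2 U) (fun _ => rfl)
      (hU (⟨x, x, hx, rfl⟩ : openImage H.2 U))

/-- An open subset of `ℝᵐ` as an object of `OR n`. -/
def OR.of (n : ℕ∞) {m : ℕ} (W : TopologicalSpace.Opens (Fin m → ℝ)) : (OR n).Obj :=
  (⟨m, W⟩ : ORObj)

/-- The category of `Cⁿ` spaces. -/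
abbrev CSpace (n : ℕ∞) := Space.{u} (OR n)

/-- A manifold of class `Cⁿ` (without boundary, of finite dimension). -/
structure Man (n : ℕ∞) where
  carrier : Type u
  E : Type
  [normedAddCommGroup : NormedAddCommGroup E]
  [normedSpace : NormedSpace ℝ E]
  [finiteDimensional : FiniteDimensional ℝ E]
  [topologicalSpace : TopologicalSpace carrier]
  [chartedSpace : ChartedSpace E carrier]
  [isManifold : IsManifold 𝓘(ℝ, E) n carrier]

attribute [instance] Man.normedAddCommGroup Man.normedSpace Man.finiteDimensional
  Man.topologicalSpace Man.chartedSpace Man.isManifold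

variable {n : ℕ∞}

/-- A map from an open subset of `ℝᵐ` to a manifold is of class `Cⁿ`. -/
def Man.IsFig (M : Man.{u} n) (H : ORObj) (d : H.2 → M.carrier) : Prop :=
  ContMDiff 𝓘(ℝ, Fin H.1 → ℝ) 𝓘(ℝ, M.E) n d

lemma Man.IsFig.comp (M : Man.{u} n) {J H : ORObj} {d : H.2 → M.carrier} (hd : M.IsFig H d)
    {f : J.2 → H.2} (hf : ContMDiff 𝓘(ℝ, Fin J.1 → ℝ) 𝓘(ℝ, Fin H.1 → ℝ) n f) :
    M.IsFig J (d ∘ f) :=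
  ContMDiff.comp hd hf

/-- The `Cⁿ` space of a manifold: its figures of type `H` are the maps `H → M` of class `Cⁿ`. -/
def Man.toCSpace (M : Man.{u} n) : CSpace.{u} n where
  carrier := M.carrier
  fig H d := M.IsFig H d
  fig_comp hf hd := hd.comp M hf
  fig_const (H : ORObj) x := (contMDiff_const : M.IsFig H fun _ => x)
  fig_sheaf (H : ORObj) d h := fun x : H.2 => by
    obtain ⟨U, hx, hU⟩ := h x
    exact contMDiffAt_of_comp_incl (i := openImageIncl H.2 U) (fun _ => rfl)
      (hU (⟨x, x, hx, rfl⟩ : openImage H.2 U))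

/-- The product of two manifolds. -/
noncomputable def Man.prod (M N : Man.{u} n) : Man.{u} n where
  carrier := M.carrier × N.carrier
  E := M.E × N.E
  chartedSpace := inferInstanceAs (ChartedSpace (ModelProd M.E N.E) (M.carrier × N.carrier))
  isManifold := by
    rw [modelWithCornersSelf_prod]
    exact inferInstanceAs (IsManifold (𝓘(ℝ, M.E).prod 𝓘(ℝ, N.E)) n (M.carrier × N.carrier))

/-- The product `M₁ × (M₂ × (… × Mₛ))` of a nonempty list of manifolds. -/
noncomputable def Man.listProd : Man.{u} n → List (Man.{u} n) → Man.{u} n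
  | M, [] => M
  | M, N :: L => M.prod (Man.listProd N L)

lemma Man.isFig_prod (M N : Man.{u} n) {H : ORObj} {d : H.2 → M.carrier × N.carrier}
    (h : (M.prod N).IsFig H d) :
    ContMDiff 𝓘(ℝ, Fin H.1 → ℝ) (𝓘(ℝ, M.E).prod 𝓘(ℝ, N.E)) n d := by
  rw [← modelWithCornersSelf_prod]
  exact h

/-- The first projection of a product of two manifolds, as an arrow of `Cⁿ`. -/
noncomputable def Man.fst (M N : Man.{u} n) : (M.prod N).toCSpace.Hom M.toCSpace :=
  ⟨fun z : M.carrier × N.carrier => z.1, fun _ _ hd =>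
    contMDiff_fst.comp (M.isFig_prod N hd)⟩

/-- The second projection of a product of two manifolds, as an arrow of `Cⁿ`. -/
noncomputable def Man.snd (M N : Man.{u} n) : (M.prod N).toCSpace.Hom N.toCSpace :=
  ⟨fun z : M.carrier × N.carrier => z.2, fun _ _ hd =>
    contMDiff_snd.comp (M.isFig_prod N hd)⟩

/-! ## Extension of `Cⁿ` spaces -/

/-- `c` is an observable on the zone `UK` of `X`: `U` is open in `X` and `c` restricts to an arrow
`(U ≺ X) → K̄`. (Only the values of `c` on `U` matter.) -/
def IsObservable (X : CSpace.{u} n) (U : Set X.carrier) {k : ℕ}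
    (K : TopologicalSpace.Opens (Fin k → ℝ)) (c : X.carrier → Fin k → ℝ) : Prop :=
  IsOpen[X.topology] U ∧
    ∃ φ : (X.sub U).Hom (Space.bar (OR.of n K)), ∀ u : U, c u = (φ u : K).1

/-- `x : ℝ → X` is continuous at `0` and nilpotent relative to `X`. -/
def IsNilpotentPath (X : CSpace.{u} n) (x : ℝ → X.carrier) : Prop :=
  Tendsto x (𝓝 0) (@nhds _ X.topology (x 0)) ∧
    ∀ (U : Set X.carrier) (k : ℕ) (K : TopologicalSpace.Opens (Fin k → ℝ))
      (c : X.carrier → Fin k → ℝ), IsObservable X U K c → x 0 ∈ U →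
        ∃ j : ℕ, (fun t => ‖c (x t) - c (x 0)‖ ^ j) =o[𝓝 0] (fun t : ℝ => t)

/-- The set of nilpotent paths of `X`. -/
def NilpotentPath (X : CSpace.{u} n) : Type u := {x : ℝ → X.carrier // IsNilpotentPath X x}

/-- Equality of nilpotent paths up to `o(t)`, tested by all observables. -/
def extSetoid (X : CSpace.{u} n) : Setoid (NilpotentPath X) where
  r x y := ∀ (U : Set X.carrier) (k : ℕ) (K : TopologicalSpace.Opens (Fin k → ℝ))
      (c : X.carrier → Fin k → ℝ), IsObservable X U K c →
        (x.1 0 ∈ U ↔ y.1 0 ∈ U) ∧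
          (x.1 0 ∈ U → (fun t => c (x.1 t) - c (y.1 t)) =o[𝓝 0] (fun t : ℝ => t))
  iseqv :=
    { refl := fun x U k K c _ => ⟨Iff.rfl, fun _ => by simp⟩
      symm := fun {x y} h U k K c hc => ⟨(h U k K c hc).1.symm, fun hy => by
        have := ((h U k K c hc).2 ((h U k K c hc).1.2 hy)).neg_left
        simpa using this⟩
      trans := fun {x y z} h h' U k K c hc =>
        ⟨(h U k K c hc).1.trans (h' U k K c hc).1, fun hx => by
          have := ((h U k K c hc).2 hx).add ((h' U k K c hc).2 ((h U k K c hc).1.1 hx))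
          simpa using this⟩ }

/-- The set of points of the extension of a `Cⁿ` space. -/
def Ext (X : CSpace.{u} n) : Type u := Quotient (extSetoid X)

/-- The class of a nilpotent path. -/
def Ext.mk {X : CSpace.{u} n} (x : NilpotentPath X) : Ext X := Quotient.mk (extSetoid X) x

lemma Space.Hom.isOpen_preimage {X : Space.{u} F} {Y : Space.{v} F} (f : X.Hom Y) {V : Set Y.carrier}
    (hV : IsOpen[Y.topology] V) : IsOpen[X.topology] (f.1 ⁻¹' V) :=
  fun H d hd => hV H _ (f.2 H d hd)

lemma IsObservable.comp {X : CSpace.{u} n} {Y : CSpace.{v} n} (f : X.Hom Y) {V : Set Y.carrier} {k : ℕ}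
    {K : TopologicalSpace.Opens (Fin k → ℝ)} {c : Y.carrier → Fin k → ℝ}
    (hc : IsObservable Y V K c) : IsObservable X (f.1 ⁻¹' V) K (fun x => c (f x)) := by
  obtain ⟨hV, φ, hφ⟩ := hc
  exact ⟨f.isOpen_preimage hV,
    ⟨fun u => φ ⟨f u.1, u.2⟩, fun H d hd => φ.2 H (fun h => ⟨f (d h).1, (d h).2⟩) (f.2 H _ hd)⟩,
    fun u => hφ ⟨f u.1, u.2⟩⟩

lemma IsNilpotentPath.comp {X : CSpace.{u} n} {Y : CSpace.{v} n} (f : X.Hom Y) {x : ℝ → X.carrier}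
    (hx : IsNilpotentPath X x) : IsNilpotentPath Y (fun t => f (x t)) := by
  refine ⟨?_, fun V k K c hc h0 => hx.2 _ k K _ (hc.comp f) h0⟩
  have hf : @Continuous _ _ X.topology Y.topology f.1 :=
    @Continuous.mk _ _ X.topology Y.topology f.1 fun V hV => f.isOpen_preimage hV
  exact Tendsto.comp (@Continuous.tendsto _ _ X.topology Y.topology _ hf (x 0)) hx.1

/-- The extension of an arrow of `Cⁿ`: composition with nilpotent paths. -/
def Ext.map {X : CSpace.{u} n} {Y : CSpace.{v} n} (f : X.Hom Y) : Ext X → Ext Y :=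
  Quotient.map (fun x : NilpotentPath X => ⟨fun t => f (x.1 t), x.2.comp f⟩)
    fun _ _ h _ k K _ hc => h _ k K _ (hc.comp f)

lemma isNilpotentPath_const (X : CSpace.{u} n) (x : X.carrier) :
    IsNilpotentPath X (fun _ => x) := by
  refine ⟨?_, fun U k K c _ _ => ⟨1, by simp⟩⟩
  let := X.topology
  exact tendsto_const_nhds

/-- The point of the extension given by a standard point. -/
def Ext.const {X : CSpace.{u} n} (x : X.carrier) : Ext X :=
  Ext.mk ⟨fun _ => x, isNilpotentPath_const X x⟩

/-! ## Extended real spaces and the category of their subsets -/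

/-- `ℝᵐ` as a `Cⁿ` space. -/
abbrev R (n : ℕ∞) (m : ℕ) : CSpace n := Space.bar (OR.of n (⊤ : TopologicalSpace.Opens (Fin m → ℝ)))

/-- A map of class `Cⁿ` between open sets, as an arrow of `Cⁿ`. -/
def OR.hom {m k : ℕ} {W : TopologicalSpace.Opens (Fin m → ℝ)}
    {K : TopologicalSpace.Opens (Fin k → ℝ)} (f : W → K)
    (hf : ContMDiff 𝓘(ℝ, Fin m → ℝ) 𝓘(ℝ, Fin k → ℝ) n fun x => (f x : Fin k → ℝ)) :
    (Space.bar (OR.of n W)).Hom (Space.bar (OR.of n K)) :=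
  ⟨f, fun H _ hd => (OR n).isMor_comp (H := H) (J := OR.of n W) (K := OR.of n K) (g := f)
    (contMDiff_subtypeVal_comp_iff.1 hf) hd⟩

/-- The inclusion of an open set in `ℝᵐ`. -/
def inclR (n : ℕ∞) {m : ℕ} (W : TopologicalSpace.Opens (Fin m → ℝ)) :
    (Space.bar (OR.of n W)).Hom (R n m) :=
  OR.hom (fun x => ⟨x, trivial⟩) contMDiff_subtype_val

/-- The extension of an open set of `ℝᵐ`, as a subset of the extension of `ℝᵐ`. -/
def extOpen (n : ℕ∞) {m : ℕ} (W : TopologicalSpace.Opens (Fin m → ℝ)) : Set (Ext (R n m)) :=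
  range (Ext.map (inclR n W))

/-- The topology of the extension of `ℝᵐ`, generated by the extensions of open sets. -/
instance (n : ℕ∞) (m : ℕ) : TopologicalSpace (Ext (R n m)) :=
  TopologicalSpace.generateFrom (range (extOpen n))

/-- The product of open sets of `ℝᵐ` and `ℝᵏ`, in `ℝᵐ⁺ᵏ`. -/
def prodOpen {m k : ℕ} (U : TopologicalSpace.Opens (Fin m → ℝ))
    (V : TopologicalSpace.Opens (Fin k → ℝ)) : TopologicalSpace.Opens (Fin (m + k) → ℝ) :=
  ⟨{w | (fun i => w (Fin.castAdd k i)) ∈ U ∧ (fun i => w (Fin.natAdd m i)) ∈ V},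
    (U.2.preimage (by fun_prop)).inter (V.2.preimage (by fun_prop))⟩

/-- The projection `U × V → ℝᵐ`. -/
def projL (n : ℕ∞) {m k : ℕ} (U : TopologicalSpace.Opens (Fin m → ℝ))
    (V : TopologicalSpace.Opens (Fin k → ℝ)) :
    (Space.bar (OR.of n (prodOpen U V))).Hom (R n m) :=
  OR.hom (fun w => ⟨fun i => w.1 (Fin.castAdd k i), trivial⟩)
    (ContMDiff.comp (g := fun (w : Fin (m + k) → ℝ) (i : Fin m) => w (Fin.castAdd k i))
      (ContDiff.contMDiff (by fun_prop)) contMDiff_subtype_val)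

/-- The projection `U × V → ℝᵏ`. -/
def projR (n : ℕ∞) {m k : ℕ} (U : TopologicalSpace.Opens (Fin m → ℝ))
    (V : TopologicalSpace.Opens (Fin k → ℝ)) :
    (Space.bar (OR.of n (prodOpen U V))).Hom (R n k) :=
  OR.hom (fun w => ⟨fun i => w.1 (Fin.natAdd m i), trivial⟩)
    (ContMDiff.comp (g := fun (w : Fin (m + k) → ℝ) (i : Fin k) => w (Fin.natAdd m i))
      (ContDiff.contMDiff (by fun_prop)) contMDiff_subtype_val)

/-- The arrows `S → T` between subsets of extended spaces `•ℝˢ`, `•ℝᵗ`: locally they are of the form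
`x ↦ •g⟨p, x⟩` with a parameter `p ∈ •U ⊆ •ℝᵐ` and `g ∈ Cⁿ(U × V, ℝᵗ)`. Here `⟨p, x⟩` is the point
`z` of `•(U × V)` with projections `p` and `x`. -/
def IsSERMor {s t : ℕ} {S : Set (Ext (R n s))} {T : Set (Ext (R n t))} (f : S → T) : Prop :=
  ∀ x₀ : S, ∃ (m : ℕ) (p : Ext (R n m)) (U : TopologicalSpace.Opens (Fin m → ℝ))
    (V : TopologicalSpace.Opens (Fin s → ℝ))
    (g : (Space.bar (OR.of n (prodOpen U V))).Hom (R n t)),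
    p ∈ extOpen n U ∧ x₀.1 ∈ extOpen n V ∧ ∀ x : S, x.1 ∈ extOpen n V →
      ∃ z : Ext (Space.bar (OR.of n (prodOpen U V))),
        Ext.map (projL n U V) z = p ∧ Ext.map (projR n U V) z = x.1 ∧ (f x).1 = Ext.map g z

/-! ### Nilpotent paths in open sets of `ℝᵐ` -/

/-- Nilpotency at `0` of a path in a normed space. -/
def NilP {E : Type*} [NormedAddCommGroup E] (c : ℝ → E) : Prop :=
  ∃ j : ℕ, (fun t => ‖c t - c 0‖ ^ j) =o[𝓝 0] (fun t : ℝ => t)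

section NilP

variable {E G : Type*} [NormedAddCommGroup E] [NormedAddCommGroup G]

lemma NilP.continuousAt {c : ℝ → E} (h : NilP c) : ContinuousAt c 0 := by
  obtain ⟨j, hj⟩ := h
  have h0 : Tendsto (fun t => ‖c t - c 0‖ ^ j) (𝓝 0) (𝓝 0) :=
    hj.isBigO.trans_tendsto tendsto_id
  rw [ContinuousAt, tendsto_iff_norm_sub_tendsto_zero, Metric.tendsto_nhds]
  intro ε hε
  filter_upwards [(Metric.tendsto_nhds.1 h0) (ε ^ j) (by positivity)] with t ht
  rw [Real.dist_eq, sub_zero, abs_of_nonneg (by positivity)] at ht ⊢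
  exact lt_of_pow_lt_pow_left₀ j hε.le ht

lemma NilP.of_le {a : ℝ → E} {b : ℝ → G} {C : ℝ} (ha : NilP a)
    (h : ∀ᶠ t in 𝓝 0, ‖b t - b 0‖ ≤ C * ‖a t - a 0‖) : NilP b := by
  obtain ⟨j, hj⟩ := ha
  refine ⟨j, (IsBigO.of_bound (|C| ^ j) ?_).trans_isLittleO hj⟩
  filter_upwards [h] with t ht
  rw [norm_pow, norm_pow, norm_norm, norm_norm, ← mul_pow]
  gcongr
  exact ht.trans (by gcongr; exact le_abs_self C)

lemma NilP.prodMk {a : ℝ → E} {b : ℝ → G} (ha : NilP a) (hb : NilP b) :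
    NilP (fun t => (a t, b t)) := by
  have hca := ha.continuousAt
  have hcb := hb.continuousAt
  obtain ⟨j, hj⟩ := ha
  obtain ⟨k, hk⟩ := hb
  have h1 : ∀ᶠ t in 𝓝 (0 : ℝ), ‖a t - a 0‖ < 1 := by
    have := (tendsto_iff_norm_sub_tendsto_zero.1 hca)
    exact this.eventually (gt_mem_nhds one_pos)
  have h2 : ∀ᶠ t in 𝓝 (0 : ℝ), ‖b t - b 0‖ < 1 := by
    have := (tendsto_iff_norm_sub_tendsto_zero.1 hcb)
    exact this.eventually (gt_mem_nhds one_pos)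
  refine ⟨max j k, IsBigO.trans_isLittleO (IsBigO.of_bound 1 ?_) (hj.add hk)⟩
  filter_upwards [h1, h2] with t h1 h2
  rw [one_mul, norm_pow, norm_norm, Prod.mk_sub_mk, Prod.norm_mk, Real.norm_eq_abs,
    abs_of_nonneg (by positivity)]
  rcases max_choice ‖a t - a 0‖ ‖b t - b 0‖ with h | h <;> rw [h]
  · have := pow_le_pow_of_le_one (norm_nonneg (a t - a 0)) h1.le (le_max_left j k)
    have : 0 ≤ ‖b t - b 0‖ ^ k := by positivity
    linarith
  · have := pow_le_pow_of_le_one (norm_nonneg (b t - b 0)) h2.le (le_max_right j k)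
    have : 0 ≤ ‖a t - a 0‖ ^ j := by positivity
    linarith

lemma NilP.congr {a b : ℝ → E} (ha : NilP a) (h : ∀ᶠ t in 𝓝 0, a t = b t) : NilP b := by
  refine ha.of_le (C := 1) ?_
  have h0 := h.self_of_nhds
  filter_upwards [h] with t ht
  rw [ht, h0, one_mul]

lemma NilP.const (e : E) : NilP (fun _ => e) := ⟨1, by simp⟩

variable [NormedSpace ℝ E] [NormedSpace ℝ G]

lemma ContDiffAt.exists_norm_le [Fact (1 ≤ n)] {g : E → G} {x : E} (h : ContDiffAt ℝ n g x) :
    ∃ C : ℝ, ∃ s ∈ 𝓝 x, ∀ y ∈ s, ∀ z ∈ s, ‖g y - g z‖ ≤ C * ‖y - z‖ := by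
  have h1 : ContDiffAt ℝ 1 g x := h.of_le (by exact_mod_cast (Fact.out : 1 ≤ n))
  obtain ⟨C, s, hs, hC⟩ := h1.exists_lipschitzOnWith
  exact ⟨C, s, hs, fun y hy z hz => hC.norm_sub_le hy hz⟩

lemma NilP.comp [Fact (1 ≤ n)] {a : ℝ → E} (ha : NilP a) {g : E → G}
    (hg : ContDiffAt ℝ n g (a 0)) : NilP (fun t => g (a t)) := by
  obtain ⟨C, s, hs, hC⟩ := ContDiffAt.exists_norm_le hg
  refine ha.of_le (C := C) ?_
  filter_upwards [ha.continuousAt hs] with t ht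
  exact hC _ ht _ (mem_of_mem_nhds hs)

lemma isLittleO_comp [Fact (1 ≤ n)] {a b : ℝ → E} (ha : NilP a) (hb : NilP b)
    (h : (fun t => a t - b t) =o[𝓝 0] (fun t : ℝ => t)) {g : E → G}
    (hg : ContDiffAt ℝ n g (a 0)) :
    (fun t => g (a t) - g (b t)) =o[𝓝 0] (fun t : ℝ => t) := by
  have h0 : a 0 = b 0 := by
    have := (h.def one_pos).self_of_nhds
    simpa [sub_eq_zero] using this
  obtain ⟨C, s, hs, hC⟩ := ContDiffAt.exists_norm_le hg
  refine (IsBigO.of_bound C ?_).trans_isLittleO h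
  filter_upwards [ha.continuousAt hs, hb.continuousAt (h0 ▸ hs)] with t ht ht'
  exact hC _ ht _ ht'

end NilP

/-! ### The points of the extension of an open set of `ℝᵐ` -/

section OpenSets

variable {m : ℕ} {W : TopologicalSpace.Opens (Fin m → ℝ)}

lemma isObservable_val : IsObservable (Space.bar (OR.of n W)) univ
    (⊤ : TopologicalSpace.Opens (Fin m → ℝ)) (fun x : W => (x : Fin m → ℝ)) :=
  ⟨fun _ _ _ => isOpen_univ,
    (inclR n W).comp ⟨fun u => u.1, fun _ _ hd => hd⟩, fun _ => rfl⟩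

lemma isOpen_of_topology {U : Set W}
    (hU : IsOpen[(Space.bar (OR.of n W)).topology] U) : IsOpen U :=
  hU (OR.of n W) id ((OR n).isMor_id _)

lemma IsObservable.exists_contDiffAt {U : Set W} {k : ℕ} {K : TopologicalSpace.Opens (Fin k → ℝ)}
    {c : W → Fin k → ℝ} (hc : IsObservable (Space.bar (OR.of n W)) U K c) {x : W} (hx : x ∈ U) :
    ∃ G : (Fin m → ℝ) → Fin k → ℝ, (∀ y : W, c y = G y) ∧ ContDiffAt ℝ n G x := by
  obtain ⟨hU, φ, hφ⟩ := hc
  let U' : TopologicalSpace.Opens W := ⟨U, isOpen_of_topology hU⟩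
  have hmem : ∀ y : openImage W U', openImageIncl W U' y ∈ U := by
    rintro ⟨_, y, hy, rfl⟩
    exact hy
  have hfig := φ.2 (OR.of n (openImage W U')) (fun y => ⟨openImageIncl W U' y, hmem y⟩)
    ((OR n).isMor_incl (OR.of n W) U')
  have h1 : ContMDiff 𝓘(ℝ, Fin m → ℝ) 𝓘(ℝ, Fin k → ℝ) n (c ∘ openImageIncl W U') := by
    have := contMDiff_subtypeVal_comp_iff.2 hfig
    refine (congrArg (ContMDiff _ _ _) (funext fun y => ?_)).mp this
    exact (hφ ⟨openImageIncl W U' y, hmem y⟩).symm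
  have h2 : ContMDiffAt 𝓘(ℝ, Fin m → ℝ) 𝓘(ℝ, Fin k → ℝ) n c x :=
    contMDiffAt_of_comp_incl (i := openImageIncl W U') (fun _ => rfl)
      (h1 (⟨x, x, hx, rfl⟩ : openImage W U'))
  refine ⟨Function.extend Subtype.val c 0,
    fun y => (Subtype.val_injective.extend_apply c _ y).symm, ?_⟩
  rw [← contMDiffAt_iff_contDiffAt, ← contMDiffAt_subtype_iff]
  refine (congrArg (fun f => ContMDiffAt _ _ _ f x) (funext fun y => ?_)).mp h2
  exact (Subtype.val_injective.extend_apply c _ y).symm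

lemma contDiff_append {m k : ℕ} :
    ContDiff ℝ n (fun z : (Fin m → ℝ) × (Fin k → ℝ) => Fin.append z.1 z.2) := by
  rw [contDiff_pi]
  intro i
  induction i using Fin.addCases with
  | left i => simp only [Fin.append_left]; fun_prop
  | right i => simp only [Fin.append_right]; fun_prop

variable [Fact (1 ≤ n)]

lemma isNilpotentPath_iff {x : ℝ → W} :
    IsNilpotentPath (Space.bar (OR.of n W)) x ↔ NilP (fun t => (x t : Fin m → ℝ)) := by
  constructor
  · intro h
    exact h.2 univ m ⊤ _ isObservable_val trivial
  · intro h
    refine ⟨?_, fun U k K c hc h0 => ?_⟩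
    · have h1 : Tendsto x (𝓝 0) (𝓝 (x 0)) := tendsto_subtype_rng.2 h.continuousAt
      exact h1.mono_right (nhds_mono (fun U hU => isOpen_of_topology hU))
    · obtain ⟨G, hG, hd⟩ := hc.exists_contDiffAt h0
      have := NilP.comp (g := G) h hd
      simp only [← hG] at this
      exact this

/-- The point of `•W` given by a nilpotent path in `ℝᵐ` with values in `W`. -/
def mkW (n : ℕ∞) [Fact (1 ≤ n)] (W : TopologicalSpace.Opens (Fin m → ℝ)) (c : ℝ → Fin m → ℝ)
    (hc : NilP c) (h : ∀ t, c t ∈ W) : Ext (Space.bar (OR.of n W)) :=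
  Ext.mk ⟨fun t => ⟨c t, h t⟩, isNilpotentPath_iff.2 hc⟩

/-- The point of `•ℝᵐ` given by a nilpotent path in `ℝᵐ`. -/
def mkR (n : ℕ∞) [Fact (1 ≤ n)] (c : ℝ → Fin m → ℝ) (hc : NilP c) : Ext (R n m) :=
  mkW n ⊤ c hc fun _ => trivial

lemma exists_mkW (z : Ext (Space.bar (OR.of n W))) : ∃ c hc h, z = mkW n W c hc h := by
  induction z using Quotient.inductionOn with
  | h x => exact ⟨fun t => (show W from x.1 t).1, isNilpotentPath_iff.1 x.2, fun t => (show W from x.1 t).2, rfl⟩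

lemma exists_mkR (z : Ext (R n m)) : ∃ c hc, z = mkR n c hc := by
  obtain ⟨c, hc, _, h⟩ := exists_mkW z
  exact ⟨c, hc, h⟩

lemma mkW_eq_iff {c c' : ℝ → Fin m → ℝ} {hc hc'} {h : ∀ t, c t ∈ W} {h' : ∀ t, c' t ∈ W} :
    mkW n W c hc h = mkW n W c' hc' h' ↔ (fun t => c t - c' t) =o[𝓝 0] (fun t : ℝ => t) := by
  constructor
  · intro e
    exact ((Quotient.exact e) univ m ⊤ _ isObservable_val).2 trivial
  · intro e
    refine Quotient.sound fun U k K d hd => ?_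
    have h0 : c 0 = c' 0 := by
      have := (e.def one_pos).self_of_nhds
      simpa [sub_eq_zero] using this
    have h0' : (⟨c 0, h 0⟩ : W) = ⟨c' 0, h' 0⟩ := Subtype.ext h0
    refine ⟨Eq.to_iff (congrArg (· ∈ U) h0'), fun hx => ?_⟩
    obtain ⟨G, hG, hdG⟩ := hd.exists_contDiffAt hx
    have := isLittleO_comp (g := G) hc hc' e hdG
    refine (congrArg (fun f => f =o[𝓝 0] fun t : ℝ => t) (funext fun t => ?_)).mp this
    exact congrArg₂ (· - ·) (hG ⟨c t, h t⟩).symm (hG ⟨c' t, h' t⟩).symm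

lemma mkR_eq_iff {c c' : ℝ → Fin m → ℝ} {hc hc'} :
    mkR n c hc = mkR n c' hc' ↔ (fun t => c t - c' t) =o[𝓝 0] (fun t : ℝ => t) :=
  mkW_eq_iff

lemma mkR_congr {c c' : ℝ → Fin m → ℝ} {hc hc'} (h : ∀ᶠ t in 𝓝 0, c t = c' t) :
    mkR n c hc = mkR n c' hc' := by
  rw [mkR_eq_iff]
  refine (IsBigO.of_bound 0 ?_).trans_isLittleO (isLittleO_zero _ _ : (fun _ => (0 : ℝ)) =o[_] _)
  filter_upwards [h] with t ht
  simp [ht]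

lemma map_mkW {k : ℕ} {K : TopologicalSpace.Opens (Fin k → ℝ)}
    (g : (Space.bar (OR.of n W)).Hom (Space.bar (OR.of n K))) {c : ℝ → Fin m → ℝ} {hc}
    {h : ∀ t, c t ∈ W} : ∃ hg : NilP (fun t => (show K from g ⟨c t, h t⟩).1),
      Ext.map g (mkW n W c hc h) = mkW n K _ hg fun t => (show K from g ⟨c t, h t⟩).2 :=
  ⟨isNilpotentPath_iff.1 ((isNilpotentPath_iff (n := n) (x := fun t => ⟨c t, h t⟩)).2 hc |>.comp g),
    rfl⟩

lemma mkR_mem_extOpen {c : ℝ → Fin m → ℝ} {hc} : mkR n c hc ∈ extOpen n W ↔ c 0 ∈ W := by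
  constructor
  · rintro ⟨z, hz⟩
    obtain ⟨a, ha, haW, rfl⟩ := exists_mkW z
    have e : (fun t => a t - c t) =o[𝓝 0] (fun t : ℝ => t) := (mkR_eq_iff (hc := ha)).1 hz
    have := (e.def one_pos).self_of_nhds
    have h0 : a 0 = c 0 := by simpa [sub_eq_zero] using this
    exact h0 ▸ haW 0
  · intro h0
    classical
    have hev : ∀ᶠ t in 𝓝 0, c t = if c t ∈ W then c t else c 0 := by
      filter_upwards [hc.continuousAt (W.2.mem_nhds h0)] with t ht
      exact (if_pos (show c t ∈ W from ht)).symm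
    refine ⟨mkW n W (fun t => if c t ∈ W then c t else c 0) (hc.congr hev) fun t => ?_, ?_⟩
    · split_ifs with h
      exacts [h, h0]
    · exact (mkR_congr (hc := hc) (hc' := hc.congr hev) hev).symm

lemma isOpen_ext_iff {𝒰 : Set (Ext (R n m))} :
    IsOpen 𝒰 ↔ ∃ V : TopologicalSpace.Opens (Fin m → ℝ), 𝒰 = extOpen n V := by
  constructor
  · intro h
    induction h with
    | basic _ h => obtain ⟨V, rfl⟩ := h; exact ⟨V, rfl⟩
    | univ =>
      refine ⟨⊤, (eq_univ_of_forall fun z => ?_).symm⟩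
      obtain ⟨c, hc, rfl⟩ := exists_mkR z
      exact mkR_mem_extOpen.2 trivial
    | inter _ _ _ _ h₁ h₂ =>
      obtain ⟨V₁, rfl⟩ := h₁
      obtain ⟨V₂, rfl⟩ := h₂
      refine ⟨V₁ ⊓ V₂, Set.ext fun z => ?_⟩
      obtain ⟨c, hc, rfl⟩ := exists_mkR z
      simp only [mem_inter_iff, mkR_mem_extOpen]
      rfl
    | sUnion S _ h =>
      choose! V hV using h
      refine ⟨⨆ s ∈ S, V s, Set.ext fun z => ?_⟩
      obtain ⟨c, hc, rfl⟩ := exists_mkR z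
      rw [mkR_mem_extOpen]
      simp only [TopologicalSpace.Opens.mem_iSup, mem_sUnion, exists_prop]
      refine exists_congr fun s => and_congr_right fun hs => ?_
      rw [hV s hs, mkR_mem_extOpen, ← hV s hs]
  · rintro ⟨V, rfl⟩
    exact TopologicalSpace.isOpen_generateFrom_of_mem ⟨V, rfl⟩

lemma isOpen_subtype_iff {S : Set (Ext (R n m))} {𝒰 : Set S} :
    IsOpen 𝒰 ↔ ∃ V : TopologicalSpace.Opens (Fin m → ℝ), 𝒰 = {x | x.1 ∈ extOpen n V} := by
  rw [isOpen_induced_iff]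
  constructor
  · rintro ⟨O, hO, rfl⟩
    obtain ⟨V, rfl⟩ := isOpen_ext_iff.1 hO
    exact ⟨V, rfl⟩
  · rintro ⟨V, rfl⟩
    exact ⟨_, isOpen_ext_iff.2 ⟨V, rfl⟩, rfl⟩

/-- The arrows of `IsSERMor`, in terms of paths. -/
def IsPathMor {s t : ℕ} {S : Set (Ext (R n s))} {T : Set (Ext (R n t))} (f : S → T) : Prop :=
  ∀ (b₀ : ℝ → Fin s → ℝ) (hb₀ : NilP b₀), mkR n b₀ hb₀ ∈ S →
    ∃ (P : Type) (_ : NormedAddCommGroup P) (_ : NormedSpace ℝ P) (_ : FiniteDimensional ℝ P)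
      (a : ℝ → P) (O : Set (P × (Fin s → ℝ))) (G : P × (Fin s → ℝ) → Fin t → ℝ),
      NilP a ∧ IsOpen O ∧ ContDiffOn ℝ n G O ∧ (a 0, b₀ 0) ∈ O ∧
      ∀ (b : ℝ → Fin s → ℝ) (hb : NilP b) (hS : mkR n b hb ∈ S), (a 0, b 0) ∈ O →
        ∃ hc : NilP (fun t => G (a t, b t)), (f ⟨mkR n b hb, hS⟩).1 = mkR n _ hc

lemma NilP.append (n : ℕ∞) [Fact (1 ≤ n)] {m k : ℕ} {a : ℝ → Fin m → ℝ} {b : ℝ → Fin k → ℝ} (ha : NilP a) (hb : NilP b) :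
    NilP (fun t => Fin.append (a t) (b t)) :=
  NilP.comp (n := n) (g := fun z : (Fin m → ℝ) × (Fin k → ℝ) => Fin.append z.1 z.2)
    (ha.prodMk hb) (contDiff_append.contDiffAt)

lemma IsSERMor.isPathMor {s t : ℕ} {S : Set (Ext (R n s))} {T : Set (Ext (R n t))} {f : S → T}
    (h : IsSERMor f) : IsPathMor f := by
  intro b₀ hb₀ hS₀
  obtain ⟨m, p, U, V, g, hp, hV, hg⟩ := h ⟨_, hS₀⟩
  obtain ⟨a, ha, rfl⟩ := exists_mkR p
  rw [mkR_mem_extOpen] at hp hV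
  let g' : prodOpen U V → Fin t → ℝ := fun w =>
    (show (⊤ : TopologicalSpace.Opens (Fin t → ℝ)) from g w).1
  have hg' : ContMDiff 𝓘(ℝ, Fin (m + s) → ℝ) 𝓘(ℝ, Fin t → ℝ) n g' :=
    contMDiff_subtypeVal_comp_iff.2 (g.2 (OR.of n (prodOpen U V)) id ((OR n).isMor_id _))
  let G' : (Fin (m + s) → ℝ) → Fin t → ℝ := Function.extend Subtype.val g' 0
  have hG' : ∀ w : prodOpen U V, G' w = g' w := fun w => Subtype.val_injective.extend_apply g' _ w
  have hG'd : ∀ w (hw : w ∈ prodOpen U V), ContDiffAt ℝ n G' w := fun w hw => by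
    rw [← contMDiffAt_iff_contDiffAt,
      ← contMDiffAt_subtype_iff (f := G') (x := (⟨w, hw⟩ : prodOpen U V))]
    exact (congrArg (fun f => ContMDiffAt _ _ _ f _) (funext hG')).mpr (hg' ⟨w, hw⟩)
  let A : (Fin m → ℝ) × (Fin s → ℝ) → Fin (m + s) → ℝ := fun z => Fin.append z.1 z.2
  have hA : ∀ u ∈ U, ∀ v ∈ V, A (u, v) ∈ prodOpen U V := fun u hu v hv => by
    constructor
    · exact (congrArg (· ∈ U) (funext fun i => Fin.append_left u v i)).mpr hu
    · exact (congrArg (· ∈ V) (funext fun i => Fin.append_right u v i)).mpr hv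
  have hGd : ∀ u ∈ U, ∀ v ∈ V, ContDiffAt ℝ n (fun z => G' (A z)) (u, v) := fun u hu v hv =>
    ContDiffAt.comp (u, v) (hG'd (A (u, v)) (hA u hu v hv)) contDiff_append.contDiffAt
  refine ⟨Fin m → ℝ, inferInstance, inferInstance, inferInstance, a, U ×ˢ V, fun z => G' (A z),
    ha, U.2.prod V.2, fun z hz => (hGd z.1 hz.1 z.2 hz.2).contDiffWithinAt, ⟨hp, hV⟩, ?_⟩
  intro b hb hS h0
  obtain ⟨z, hz1, hz2, hz3⟩ := hg ⟨_, hS⟩ ((mkR_mem_extOpen (hc := hb)).2 h0.2)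
  obtain ⟨w, hw, hwm, rfl⟩ := exists_mkW z
  have hab : NilP (fun t => (a t, b t)) := ha.prodMk hb
  refine ⟨NilP.comp (g := fun z => G' (A z)) hab (hGd _ h0.1 _ h0.2), ?_⟩
  rw [hz3]
  obtain ⟨hgw, e⟩ := map_mkW g (hc := hw) (h := hwm)
  rw [e]
  obtain ⟨h1, e1⟩ := map_mkW (projL n U V) (hc := hw) (h := hwm)
  obtain ⟨h2, e2⟩ := map_mkW (projR n U V) (hc := hw) (h := hwm)
  have l1 : (fun t => (fun i => w t (Fin.castAdd s i)) - a t) =o[𝓝 0] (fun t : ℝ => t) :=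
    (mkR_eq_iff (hc := h1) (hc' := ha)).1 (e1.symm.trans hz1)
  have l2 : (fun t => (fun i => w t (Fin.natAdd m i)) - b t) =o[𝓝 0] (fun t : ℝ => t) :=
    (mkR_eq_iff (hc := h2) (hc' := hb)).1 (e2.symm.trans hz2)
  have l : (fun t => ((fun i => w t (Fin.castAdd s i) : Fin m → ℝ),
      (fun i => w t (Fin.natAdd m i) : Fin s → ℝ)) - (a t, b t)) =o[𝓝 0] (fun t : ℝ => t) :=
    l1.prod_left l2
  have := isLittleO_comp (g := fun z => G' (A z)) (h1.prodMk h2) hab l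
    (hGd _ (hwm 0).1 _ (hwm 0).2)
  refine (mkR_eq_iff (hc := hgw)).2 ((congrArg (fun f => f =o[𝓝 0] fun t : ℝ => t)
    (funext fun t => ?_)).mp this)
  congr 1
  have : A ((fun i => w t (Fin.castAdd s i) : Fin m → ℝ),
      (fun i => w t (Fin.natAdd m i) : Fin s → ℝ)) = w t := Fin.append_castAdd_natAdd
  exact (congrArg G' this).trans (hG' ⟨w t, hwm t⟩)

lemma IsPathMor.isSERMor {s t : ℕ} {S : Set (Ext (R n s))} {T : Set (Ext (R n t))} {f : S → T}
    (h : IsPathMor f) : IsSERMor f := by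
  classical
  rintro ⟨x₀, hx₀⟩
  obtain ⟨b₀, hb₀, rfl⟩ := exists_mkR x₀
  obtain ⟨P, _, _, _, a, O, G, ha, hO, hG, h0, hf⟩ := h b₀ hb₀ hx₀
  let e : P ≃L[ℝ] (Fin (Module.finrank ℝ P) → ℝ) := (Module.finBasis ℝ P).equivFunL
  obtain ⟨U', V, hU', haU', hV, hbV, hUV⟩ := mem_nhds_prod_iff'.1 (hO.mem_nhds h0)
  let U : TopologicalSpace.Opens (Fin (Module.finrank ℝ P) → ℝ) :=
    ⟨e.symm ⁻¹' U', hU'.preimage e.symm.continuous⟩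
  let V : TopologicalSpace.Opens (Fin s → ℝ) := ⟨V, hV⟩
  let B : (Fin (Module.finrank ℝ P + s) → ℝ) → P × (Fin s → ℝ) := fun w =>
    (e.symm fun i => w (Fin.castAdd s i), fun i => w (Fin.natAdd _ i))
  have hB : ContDiff ℝ n B := by
    refine ContDiff.prodMk (e.symm.contDiff.comp ?_) ?_ <;> fun_prop
  have hBO : ∀ w ∈ prodOpen U V, B w ∈ O := fun w hw => hUV ⟨hw.1, hw.2⟩
  have hgd : ContMDiff 𝓘(ℝ, Fin (Module.finrank ℝ P + s) → ℝ) 𝓘(ℝ, Fin t → ℝ) n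
      (fun w : prodOpen U V => G (B w)) := fun w => by
    rw [contMDiffAt_subtype_iff (f := fun w => G (B w)), contMDiffAt_iff_contDiffAt]
    exact ContDiffAt.comp _ (hG.contDiffAt (hO.mem_nhds (hBO w w.2))) hB.contDiffAt
  have hea : NilP (fun t => e (a t)) := ha.comp (n := n) (g := e) e.contDiff.contDiffAt
  refine ⟨_, mkR n _ hea, U, V, OR.hom (fun w => ⟨G (B w), trivial⟩) hgd,
    mkR_mem_extOpen.2 (by simpa [U] using haU'), (mkR_mem_extOpen (hc := hb₀)).2 hbV, ?_⟩
  rintro ⟨x, hx⟩ hxV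
  obtain ⟨b, hb, rfl⟩ := exists_mkR x
  have hxV : b 0 ∈ V := (mkR_mem_extOpen (hc := hb)).1 hxV
  let c : ℝ → Fin (Module.finrank ℝ P + s) → ℝ := fun t => Fin.append (e (a t)) (b t)
  have hc : NilP c := hea.append n hb
  have hc0 : c 0 ∈ prodOpen U V := by
    simpa [c, prodOpen, U] using ⟨haU', hxV⟩
  have hBc : ∀ t, B (c t) = (a t, b t) := fun t => by simp [B, c]
  have hev : ∀ᶠ t in 𝓝 0, c t = if c t ∈ prodOpen U V then c t else c 0 := by
    filter_upwards [hc.continuousAt ((prodOpen U V).2.mem_nhds hc0)] with t ht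
    exact (if_pos (show c t ∈ prodOpen U V from ht)).symm
  have hmem : ∀ t, (if c t ∈ prodOpen U V then c t else c 0) ∈ prodOpen U V := fun t => by
    split_ifs with h
    exacts [h, hc0]
  refine ⟨mkW n (prodOpen U V) _ (hc.congr hev) hmem, ?_, ?_, ?_⟩
  · obtain ⟨h1, e1⟩ := map_mkW (projL n U V) (hc := hc.congr hev) (h := hmem)
    rw [e1]
    refine mkR_congr (hc := h1) ?_
    filter_upwards [hev] with t ht
    refine (congrArg (fun w : Fin (Module.finrank ℝ P + s) → ℝ =>
      fun i => w (Fin.castAdd s i)) ht.symm).trans ?_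
    simp [c]
  · obtain ⟨h1, e1⟩ := map_mkW (projR n U V) (hc := hc.congr hev) (h := hmem)
    rw [e1]
    refine mkR_congr (hc := h1) (hc' := hb) ?_
    filter_upwards [hev] with t ht
    refine (congrArg (fun w : Fin (Module.finrank ℝ P + s) → ℝ =>
      fun i => w (Fin.natAdd _ i)) ht.symm).trans ?_
    simp [c]
  · obtain ⟨h1, e1⟩ := map_mkW (OR.hom (n := n) (K := ⊤)
      (fun w : prodOpen U V => ⟨G (B w), trivial⟩) hgd) (hc := hc.congr hev) (h := hmem)
    obtain ⟨h2, e2⟩ := hf b hb hx (hUV ⟨haU', hxV⟩)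
    rw [e1, e2]
    refine mkR_congr (hc := h2) ?_
    filter_upwards [hev] with t ht
    exact (congrArg G (hBc t)).symm.trans (congrArg (fun w => G (B w)) ht)

lemma isSERMor_iff {s t : ℕ} {S : Set (Ext (R n s))} {T : Set (Ext (R n t))} {f : S → T} :
    IsSERMor f ↔ IsPathMor f := ⟨fun h => h.isPathMor, fun h => h.isSERMor⟩

/-! ### The laws of the category of subsets of extended real spaces -/

lemma isSERMor_id {s : ℕ} (S : Set (Ext (R n s))) : IsSERMor (id : S → S) := by
  refine IsPathMor.isSERMor fun b₀ _ _ => ⟨ℝ, inferInstance, inferInstance, inferInstance,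
    fun _ => 0, univ, Prod.snd, NilP.const 0, isOpen_univ, contDiffOn_snd, trivial,
    fun b hb _ _ => ⟨hb, rfl⟩⟩

lemma IsSERMor.comp {s t r : ℕ} {S : Set (Ext (R n s))} {T : Set (Ext (R n t))}
    {Q : Set (Ext (R n r))} {g : T → Q} {f : S → T} (hg : IsSERMor g) (hf : IsSERMor f) :
    IsSERMor (g ∘ f) := by
  refine IsPathMor.isSERMor fun b₀ hb₀ hS₀ => ?_
  obtain ⟨P, _, _, _, a, O, G, ha, hO, hG, h0, hfG⟩ := hf.isPathMor b₀ hb₀ hS₀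
  obtain ⟨hc₀, e₀⟩ := hfG b₀ hb₀ hS₀ h0
  obtain ⟨P', _, _, _, a', O', G', ha', hO', hG', h0', hgG⟩ :=
    hg.isPathMor _ hc₀ (e₀ ▸ (f ⟨_, hS₀⟩).2)
  let π : (P' × P) × (Fin s → ℝ) → P × (Fin s → ℝ) := fun z => (z.1.2, z.2)
  let k : (P' × P) × (Fin s → ℝ) → P' × (Fin t → ℝ) := fun z => (z.1.1, G (π z))
  have hπ : ContDiff ℝ n π := by fun_prop
  have hk : ContDiffOn ℝ n k (π ⁻¹' O) :=
    ContDiffOn.prodMk (by fun_prop) (hG.comp hπ.contDiffOn fun _ h => h)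
  have hπO : IsOpen (π ⁻¹' O) := hO.preimage hπ.continuous
  refine ⟨P' × P, inferInstance, inferInstance, inferInstance, fun t => (a' t, a t),
    π ⁻¹' O ∩ k ⁻¹' O', fun z => G' (k z), ha'.prodMk ha,
    hk.continuousOn.isOpen_inter_preimage hπO hO',
    hG'.comp (hk.mono inter_subset_left) fun _ h => h.2, ⟨h0, h0'⟩, ?_⟩
  intro b hb hS hmem
  obtain ⟨hc, e⟩ := hfG b hb hS hmem.1
  have hT : mkR n (fun t => G (a t, b t)) hc ∈ T := e ▸ (f ⟨_, hS⟩).2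
  obtain ⟨hd, e'⟩ := hgG _ hc hT hmem.2
  refine ⟨hd, ?_⟩
  rw [← e']
  exact congrArg (fun x => (g x).1) (Subtype.ext e)

lemma isSERMor_const {s t : ℕ} (S : Set (Ext (R n s))) {T : Set (Ext (R n t))} (y : T) :
    IsSERMor (fun _ : S => y) := by
  obtain ⟨y, hy⟩ := y
  obtain ⟨a, ha, rfl⟩ := exists_mkR y
  exact IsPathMor.isSERMor fun b₀ _ _ => ⟨Fin t → ℝ, inferInstance, inferInstance, inferInstance,
    a, univ, Prod.fst, ha, isOpen_univ, contDiffOn_fst, trivial, fun b hb _ _ => ⟨ha, rfl⟩⟩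

lemma IsSERMor.continuous {s t : ℕ} {S : Set (Ext (R n s))} {T : Set (Ext (R n t))} {f : S → T}
    (hf : IsSERMor f) : Continuous f := by
  refine ⟨fun 𝒰 h𝒰 => ?_⟩
  obtain ⟨V', rfl⟩ := isOpen_subtype_iff.1 h𝒰
  rw [isOpen_iff_forall_mem_open]
  rintro ⟨x, hx⟩ hxV
  obtain ⟨b₀, hb₀, rfl⟩ := exists_mkR x
  obtain ⟨P, _, _, _, a, O, G, ha, hO, hG, h0, hfG⟩ := hf.isPathMor b₀ hb₀ hx
  let ι : (Fin s → ℝ) → P × (Fin s → ℝ) := fun v => (a 0, v)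
  have hι : Continuous ι := by fun_prop
  let V : TopologicalSpace.Opens (Fin s → ℝ) := ⟨ι ⁻¹' (O ∩ G ⁻¹' V'),
    (hG.continuousOn.isOpen_inter_preimage hO V'.2).preimage hι⟩
  have key : ∀ (b : ℝ → Fin s → ℝ) (hb : NilP b) (hS : mkR n b hb ∈ S), (a 0, b 0) ∈ O →
      ((f ⟨mkR n b hb, hS⟩).1 ∈ extOpen n V' ↔ G (a 0, b 0) ∈ V') := by
    intro b hb hS h
    obtain ⟨hc, e⟩ := hfG b hb hS h
    rw [e]
    exact mkR_mem_extOpen (hc := hc)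
  refine ⟨{x | x.1 ∈ extOpen n V}, ?_, isOpen_subtype_iff.2 ⟨V, rfl⟩, ?_⟩
  · rintro ⟨x, hx⟩ hxV
    obtain ⟨b, hb, rfl⟩ := exists_mkR x
    have hbV : b 0 ∈ V := (mkR_mem_extOpen (hc := hb)).1 hxV
    exact (key b hb hx hbV.1).2 hbV.2
  · exact (mkR_mem_extOpen (hc := hb₀)).2 ⟨h0, (key b₀ hb₀ hx h0).1 hxV⟩

lemma isSERMor_of_val {s : ℕ} {S T : Set (Ext (R n s))} {f : S → T} (hf : ∀ x, (f x).1 = x.1) :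
    IsSERMor f := by
  refine IsPathMor.isSERMor fun b₀ _ _ => ⟨ℝ, inferInstance, inferInstance, inferInstance,
    fun _ => 0, univ, Prod.snd, NilP.const 0, isOpen_univ, contDiffOn_snd, trivial,
    fun b hb _ _ => ⟨hb, hf _⟩⟩

lemma isSERMor_sheaf {s t : ℕ} {S : Set (Ext (R n s))} {T : Set (Ext (R n t))} {f : S → T}
    (h : ∀ x : S, ∃ (U : Set S) (S' : Set (Ext (R n s))) (i : S' → S), IsOpen U ∧ x ∈ U ∧
      (∀ y, (i y).1 = y.1) ∧ (∀ y ∈ U, y.1 ∈ S') ∧ IsSERMor (f ∘ i)) : IsSERMor f := by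
  refine IsPathMor.isSERMor fun b₀ hb₀ hS₀ => ?_
  obtain ⟨U, S', i, hU, hxU, hi, hUS, hf⟩ := h ⟨_, hS₀⟩
  obtain ⟨V, rfl⟩ := isOpen_subtype_iff.1 hU
  have hbV : b₀ 0 ∈ V := (mkR_mem_extOpen (hc := hb₀)).1 hxU
  obtain ⟨P, _, _, _, a, O, G, ha, hO, hG, h0, hfG⟩ := hf.isPathMor b₀ hb₀ (hUS _ hxU)
  refine ⟨P, inferInstance, inferInstance, inferInstance, a, O ∩ univ ×ˢ V, G, ha,
    hO.inter (isOpen_univ.prod V.2), hG.mono inter_subset_left, ⟨h0, trivial, hbV⟩, ?_⟩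
  intro b hb hS hmem
  have hbU : mkR n b hb ∈ extOpen n V := (mkR_mem_extOpen (hc := hb)).2 hmem.2.2
  obtain ⟨hc, e⟩ := hfG b hb (hUS ⟨_, hS⟩ hbU) hmem.1
  refine ⟨hc, ?_⟩
  rw [← e]
  exact congrArg (fun x => (f x).1) (Subtype.ext (hi ⟨_, hUS ⟨_, hS⟩ hbU⟩).symm)

end OpenSets

/-- The subsets of the extended spaces `•ℝˢ`, `s ∈ ℕ`. -/
abbrev SERObj (n : ℕ∞) := Σ s : ℕ, Set (Ext (R n s))

/-- The category of subsets of the extended spaces `•ℝˢ`. -/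
def SER (n : ℕ∞) [Fact (1 ≤ n)] : FigCat where
  Obj := SERObj n
  carrier H := H.2
  top _ := inferInstance
  IsMor f := IsSERMor f
  restr H U := ⟨H.1, Subtype.val '' (U : Set H.2)⟩
  incl H U := fun x => ⟨x.1, Subtype.coe_image_subset _ _ x.2⟩
  incl_isOpenEmbedding H U := by
    refine ⟨.of_comp (by fun_prop) continuous_subtype_val .subtypeVal, ?_⟩
    convert U.2 using 1
    ext x
    constructor
    · rintro ⟨⟨_, y, hy, rfl⟩, rfl⟩
      exact hy
    · intro hx
      exact ⟨⟨x, x, hx, rfl⟩, rfl⟩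
  range_incl H U := by
    ext x
    constructor
    · rintro ⟨⟨_, y, hy, rfl⟩, rfl⟩
      exact hy
    · intro hx
      exact ⟨⟨x, x, hx, rfl⟩, rfl⟩
  continuous_of_isMor h := h.continuous
  isMor_id H := isSERMor_id H.2
  isMor_comp hg hf := hg.comp hf
  isMor_const y := isSERMor_const _ y
  isMor_incl _ _ := isSERMor_of_val fun _ => rfl
  isMor_lift {H K V f} h := fun x₀ => h x₀
  isMor_sheaf {H K f} h := isSERMor_sheaf fun x => by
    obtain ⟨U, hx, hU⟩ := h x
    exact ⟨U, Subtype.val '' (U : Set H.2),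
      fun x => ⟨x.1, Subtype.coe_image_subset _ _ x.2⟩, U.2, hx, fun _ => rfl,
      fun y hy => ⟨y, hy, rfl⟩, hU⟩

/-! ## Extended spaces -/

/-- The category of extended `Cⁿ` spaces. -/
abbrev ECSpace (n : ℕ∞) [Fact (1 ≤ n)] := Space.{u} (SER n)

variable [Fact (1 ≤ n)]

/-- The extended space `•(ZX)` induced on `Z ⊆ •X` by the `Cⁿ` space `X`: it is generated by the
constant maps and by the maps `•h|_T : T → Z`, where `h : V̄ → X` is a figure of `X` and
`T ⊆ •V ⊆ •ℝᵗ`. -/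
def extInduced (X : CSpace.{u} n) (Z : Set (Ext X)) : ECSpace.{u} n :=
  Space.gen (F := SER n) Z
    (fun (T : SERObj n) => {d : T.2 → Z | (∃ z, ∀ x, d x = z) ∨
      ∃ (V : TopologicalSpace.Opens (Fin T.1 → ℝ)) (h : (Space.bar (OR.of n V)).Hom X),
        ∀ x : T.2, ∃ y : Ext (Space.bar (OR.of n V)),
          Ext.map (inclR n V) y = x.1 ∧ (d x).1 = Ext.map h y})
    (fun _ x => Or.inl ⟨x, fun _ => rfl⟩)

/-- The extension `•X` of a `Cⁿ` space as an extended space. -/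
def extSpace (X : CSpace.{u} n) : ECSpace.{u} n := extInduced X univ

/-- A point of `•X`, as a point of the extended space. -/
def Ext.toSpace {X : CSpace.{u} n} (z : Ext X) : (extSpace X).carrier :=
  (⟨z, trivial⟩ : (univ : Set (Ext X)))

/-- The set of first order infinitesimals: the points `h` of `•ℝ` with `h(t) = O(t)`. -/
def firstOrder (n : ℕ∞) : Set (Ext (R n 1)) :=
  {h | ∃ c : NilpotentPath (R n 1), h = Ext.mk c ∧
    (fun t => (show (⊤ : TopologicalSpace.Opens (Fin 1 → ℝ)) from c.1 t).1) =O[𝓝 0]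
      (fun t : ℝ => t)}

/-- The extended space `D` of first order infinitesimals. -/
def D (n : ℕ∞) [Fact (1 ≤ n)] : ECSpace n := extInduced (R n 1) (firstOrder n)

/-- The point `0` of `D`. -/
def D.zero (n : ℕ∞) [Fact (1 ≤ n)] : (D n).carrier :=
  show firstOrder n from
    ⟨Ext.const (X := R n 1) (⟨0, trivial⟩ : (⊤ : TopologicalSpace.Opens (Fin 1 → ℝ))), _, rfl,
      isBigO_zero _ _⟩

/-- An extended space `X` is infinitesimally linear if for every `k > 1` any `k` tangent vectors
`tᵢ : D → X` at a common point `x` determine a unique arrow `p : Dᵏ → X` with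
`p(0, …, 0, h, 0, …, 0) = tᵢ(h)` for all `i` and all `h ∈ D` (with `h` in the `i`-th place). -/
def InfLinear (X : ECSpace.{u} n) : Prop :=
  ∀ k : ℕ, 1 < k → ∀ (x : X.carrier) (t : Fin k → (D n).Hom X), (∀ i, t i (D.zero n) = x) →
    ∃! p : ((D n).pow k).Hom X, ∀ (i : Fin k) (h : (D n).carrier),
      p (Function.update (fun _ => D.zero n) i h) = t i h

/-- The extension of a manifold. -/
def Man.ext (M : Man.{u} n) : ECSpace.{u} n := extSpace M.toCSpace

/-- The iterated exponential `(…((X^{•M₁})^{•M₂})…)^{•Mₛ}`. -/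
def iterExp : ECSpace.{u} n → List (Man.{u} n) → ECSpace.{u} n
  | X, [] => X
  | X, M :: L => iterExp (M.ext.exp X) L

/-- The evaluation `F ↦ F(mₛ)…(m₁)` of an element `F` of `(…((X^{•M₁})^{•M₂})…)^{•Mₛ}` at the point
`z` of `•(M₁ × … × Mₛ)` with projections `mᵢ ∈ •Mᵢ`. -/
noncomputable def evalIter : (X : ECSpace.{u} n) → (M : Man.{u} n) → (L : List (Man.{u} n)) →
    (iterExp X (M :: L)).carrier → Ext (M.listProd L).toCSpace → X.carrier
  | _, _, [], F, z => F.1 z.toSpace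
  | X, M, N :: L, F, z =>
    (evalIter (M.ext.exp X) N L F (Ext.map (M.snd (N.listProd L)) z)).1
      (Ext.map (M.fst (N.listProd L)) z).toSpace

end IDG

/-! Everything is reduced by charts to one first order Taylor estimate in `•ℝᵐ`. An arrow `Dᵏ → •ℝᵐ`
is locally of the form `b ↦ •G⟨a, b⟩` with `G` of class `Cⁿ`, `n ≥ 1`. Each path representing a
point of `Dᵏ` vanishes at `t = 0`, so the only open neighbourhood of `0` in `Dᵏ` is `Dᵏ` itself, and
the local expression at `0` holds everywhere. Strict differentiability of `G` at `(a 0, 0)` gives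
`G(a t, b t) = G(a t, 0) + L(0, b t) + o(t)` when `b = O(t)`. Since `o(t)` is invisible in `•ℝᵐ`,
the arrow is affine: its value at `d` is its value at `0` plus the sum of its increments along the
axes (`SMor.eq_add_sum`).

For a locally Euclidean space `X`, such as a manifold, the points of `•X` in a chart domain form an
open set, on which figures are the maps with `SMor` coordinates (`CChart.isOpen_preimage_dom`,
`CChart.sMor_coord`, `CChart.fig_of_sMor_coord`). An arrow from `Dᵏ` stays in any chart domain
containing its value at `0`, so in coordinates it is affine (`CChart.coord_hom_eq`). This determines
it from its axes (`hom_pow_ext`), and the same formula builds it from given tangent vectors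
(`exists_hom_pow`).

For an exponential `(•X)^A` the problem is solved at each `a ∈ A`. The affine formula, read in a
chart around the common value of the tangent vectors at `a`, shows that the solutions depend on `(d,
a)` by an arrow (`infLinear_exp`); `A` may be any extended space.

The isomorphism is cartesian closedness together with `•(M × N) ≅ •M × •N`, proved by product charts
(`Ext.prod_injective`, `Ext.exists_prod`, `Man.ext_prod_fig`). It gives `expProdIso`, which is
iterated along the list; linearity of the iterated exponential is then transported along the
isomorphism. -/

namespace IDG

section

variable {n : ℕ∞} [Fact (1 ≤ n)]

/-! ## Addition on extended real spaces -/

lemma NilP.add {m : ℕ} (n : ℕ∞) [Fact (1 ≤ n)] {a b : ℝ → Fin m → ℝ} (ha : NilP a) (hb : NilP b) :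
    NilP (fun t => a t + b t) :=
  NilP.comp (n := n) (g := fun z : (Fin m → ℝ) × (Fin m → ℝ) => z.1 + z.2) (ha.prodMk hb)
    (ContDiff.contDiffAt (by fun_prop))

lemma NilP.neg {m : ℕ} {a : ℝ → Fin m → ℝ} (ha : NilP a) : NilP (fun t => -a t) :=
  ha.of_le (C := 1) (Eventually.of_forall fun t => by
    rw [neg_sub_neg, norm_sub_rev, one_mul])

lemma NilP.sub {m : ℕ} (n : ℕ∞) [Fact (1 ≤ n)] {a b : ℝ → Fin m → ℝ} (ha : NilP a) (hb : NilP b) :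
    NilP (fun t => a t - b t) := by
  simpa only [sub_eq_add_neg] using ha.add n hb.neg

section Add

variable {m : ℕ}

/-- A nilpotent path representing a point of `•ℝᵐ`. -/
noncomputable def rep (z : Ext (R n m)) : ℝ → Fin m → ℝ := (exists_mkR z).choose

lemma nilP_rep (z : Ext (R n m)) : NilP (rep z) := (exists_mkR z).choose_spec.choose

lemma mkR_rep (z : Ext (R n m)) : mkR n (rep z) (nilP_rep z) = z :=
  (exists_mkR z).choose_spec.choose_spec.symm

/-- The operations below are defined through the chosen paths `rep`; this estimate allows computing
them on any representatives. -/
lemma rep_mkR_sub_isLittleO (a : ℝ → Fin m → ℝ) (ha : NilP a) :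
    (fun t => rep (mkR n a ha) t - a t) =o[𝓝 0] (fun t : ℝ => t) :=
  (mkR_eq_iff (hc := nilP_rep _) (hc' := ha)).1 (mkR_rep _)

noncomputable instance : Add (Ext (R n m)) :=
  ⟨fun z w => mkR n _ ((nilP_rep z).add n (nilP_rep w))⟩

noncomputable instance : Neg (Ext (R n m)) := ⟨fun z => mkR n _ (nilP_rep z).neg⟩

instance : Zero (Ext (R n m)) := ⟨mkR n (fun _ => 0) (NilP.const 0)⟩

lemma mkR_zero : mkR n (fun _ => (0 : Fin m → ℝ)) (NilP.const 0) = 0 := rfl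

lemma mkR_add {a b : ℝ → Fin m → ℝ} (ha : NilP a) (hb : NilP b) :
    mkR n a ha + mkR n b hb = mkR n _ (ha.add n hb) := by
  exact mkR_eq_iff.2 (((rep_mkR_sub_isLittleO (n := n) a ha).add (rep_mkR_sub_isLittleO b hb)).congr_left
    fun t => by abel)

lemma mkR_neg {a : ℝ → Fin m → ℝ} (ha : NilP a) : -mkR n a ha = mkR n _ ha.neg := by
  exact mkR_eq_iff.2 ((rep_mkR_sub_isLittleO (n := n) a ha).neg_left.congr_left
    fun t => by abel)

lemma mkR_ext {a b : ℝ → Fin m → ℝ} {ha : NilP a} {hb : NilP b} (h : ∀ t, a t = b t) :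
    mkR n a ha = mkR n b hb :=
  mkR_congr (Eventually.of_forall h)

/-- Sums and differences suffice to express that an arrow on `Dᵏ` is affine; no scalar
multiplication is needed. -/
noncomputable instance : AddCommGroup (Ext (R n m)) where
  add_assoc x y z := by
    obtain ⟨a, ha, rfl⟩ := exists_mkR x
    obtain ⟨b, hb, rfl⟩ := exists_mkR y
    obtain ⟨c, hc, rfl⟩ := exists_mkR z
    simp only [mkR_add]
    exact mkR_ext fun t => add_assoc _ _ _
  zero_add x := by
    obtain ⟨a, ha, rfl⟩ := exists_mkR x
    rw [← mkR_zero, mkR_add]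
    exact mkR_ext fun t => zero_add _
  add_zero x := by
    obtain ⟨a, ha, rfl⟩ := exists_mkR x
    rw [← mkR_zero, mkR_add]
    exact mkR_ext fun t => add_zero _
  add_comm x y := by
    obtain ⟨a, ha, rfl⟩ := exists_mkR x
    obtain ⟨b, hb, rfl⟩ := exists_mkR y
    simp only [mkR_add]
    exact mkR_ext fun t => add_comm _ _
  neg_add_cancel x := by
    obtain ⟨a, ha, rfl⟩ := exists_mkR x
    rw [mkR_neg, mkR_add, ← mkR_zero]
    exact mkR_ext fun t => neg_add_cancel _
  nsmul := nsmulRec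
  zsmul := zsmulRec

lemma mkR_sub {a b : ℝ → Fin m → ℝ} (ha : NilP a) (hb : NilP b) :
    mkR n a ha - mkR n b hb = mkR n _ (ha.sub n hb) := by
  rw [sub_eq_add_neg, mkR_neg, mkR_add]
  exact mkR_ext fun t => (sub_eq_add_neg _ _).symm

lemma mkR_sum {ι : Type*} (I : Finset ι) {a : ι → ℝ → Fin m → ℝ} (ha : ∀ i, NilP (a i)) :
    ∃ h : NilP (fun t => ∑ i ∈ I, a i t), ∑ i ∈ I, mkR n (a i) (ha i) = mkR n _ h := by
  classical
  induction I using Finset.induction_on with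
  | empty => exact ⟨by simpa using NilP.const 0, by rw [Finset.sum_empty, ← mkR_zero]; simp⟩
  | insert i I hi ih =>
    obtain ⟨h, e⟩ := ih
    refine ⟨by simpa only [Finset.sum_insert hi] using (ha i).add n h, ?_⟩
    rw [Finset.sum_insert hi, e, mkR_add]
    exact mkR_ext fun t => by rw [Finset.sum_insert hi]

end Add

/-! ## Arrows from a subset of an extended real space to an extended real space -/

/-- The arrows from `S ⊆ •ℝˢ` to `•ℝᵗ`. -/
def SMor {s t : ℕ} {S : Set (Ext (R n s))} (f : S → Ext (R n t)) : Prop :=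
  IsPathMor (T := univ) fun x => ⟨f x, trivial⟩

section SMor

variable {s t : ℕ} {S : Set (Ext (R n s))}

/-- `IsPathMor` sees only the underlying point of `•ℝᵗ`, so the choice of the target subset `T` is
immaterial. -/
lemma isSERMor_iff_sMor {T : Set (Ext (R n t))} {f : S → T} :
    IsSERMor f ↔ SMor fun x => (f x).1 :=
  isSERMor_iff

lemma SMor.comp {r : ℕ} {Q : Set (Ext (R n r))} {g : S → Ext (R n t)} (hg : SMor g) {f : Q → S}
    (hf : SMor fun x => (f x).1) : SMor (g ∘ f) :=
  isSERMor_iff_sMor.1 ((isSERMor_iff_sMor (f := fun x => (⟨g x, trivial⟩ : univ))).2 hg |>.comp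
    (isSERMor_iff_sMor.2 hf))

lemma sMor_const (z : Ext (R n t)) : SMor (fun _ : S => z) :=
  isSERMor_iff_sMor.1 (isSERMor_const S (⟨z, trivial⟩ : univ))

/-- Local expressions of `f` and `g` with parameters in `P` and `P'` combine into one with parameter
in `P × P'`, followed by `G`. Closure under sums, differences and pairing are instances. -/
lemma SMor.map₂ {a b c : ℕ} {f : S → Ext (R n a)} {g : S → Ext (R n b)} (hf : SMor f)
    (hg : SMor g) {G : (Fin a → ℝ) × (Fin b → ℝ) → Fin c → ℝ} (hG : ContDiff ℝ n G)
    {k : S → Ext (R n c)}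
    (hk : ∀ x α hα β hβ, f x = mkR n α hα → g x = mkR n β hβ →
      ∃ h, k x = mkR n (fun t => G (α t, β t)) h) : SMor k := by
  intro b₀ hb₀ hS₀
  obtain ⟨P, _, _, _, p, O, A, hp, hO, hA, h0, hfA⟩ := hf b₀ hb₀ hS₀
  obtain ⟨P', _, _, _, p', O', A', hp', hO', hA', h0', hgA⟩ := hg b₀ hb₀ hS₀
  let π : (P × P') × (Fin s → ℝ) → P × (Fin s → ℝ) := fun z => (z.1.1, z.2)
  let π' : (P × P') × (Fin s → ℝ) → P' × (Fin s → ℝ) := fun z => (z.1.2, z.2)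
  have hπ : ContDiff ℝ n π := by fun_prop
  have hπ' : ContDiff ℝ n π' := by fun_prop
  refine ⟨P × P', inferInstance, inferInstance, inferInstance, fun t => (p t, p' t),
    π ⁻¹' O ∩ π' ⁻¹' O', fun z => G (A (π z), A' (π' z)), hp.prodMk hp',
    (hO.preimage hπ.continuous).inter (hO'.preimage hπ'.continuous), ?_, ⟨h0, h0'⟩, ?_⟩
  · exact hG.comp_contDiffOn ((hA.comp hπ.contDiffOn fun _ h => h.1).prodMk
      (hA'.comp hπ'.contDiffOn fun _ h => h.2))
  · intro b hb hS hmem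
    obtain ⟨h1, e1⟩ := hfA b hb hS hmem.1
    obtain ⟨h2, e2⟩ := hgA b hb hS hmem.2
    exact hk _ _ h1 _ h2 e1 e2

lemma SMor.add {f g : S → Ext (R n t)} (hf : SMor f) (hg : SMor g) :
    SMor (fun x => f x + g x) :=
  hf.map₂ hg (G := fun z => z.1 + z.2) (by fun_prop) fun x α hα β hβ e e' =>
    ⟨hα.add n hβ, by rw [e, e', mkR_add]⟩

lemma SMor.sub {f g : S → Ext (R n t)} (hf : SMor f) (hg : SMor g) :
    SMor (fun x => f x - g x) :=
  hf.map₂ hg (G := fun z => z.1 - z.2) (by fun_prop) fun x α hα β hβ e e' =>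
    ⟨hα.sub n hβ, by rw [e, e', mkR_sub]⟩

lemma SMor.sum {ι : Type*} (I : Finset ι) {f : ι → S → Ext (R n t)} (hf : ∀ i, SMor (f i)) :
    SMor (fun x => ∑ i ∈ I, f i x) := by
  classical
  induction I using Finset.induction_on with
  | empty => simpa using sMor_const 0
  | insert i I hi ih => simpa only [Finset.sum_insert hi] using (hf i).add ih

/-- The pairing `•ℝᵃ × •ℝᵇ → •ℝᵃ⁺ᵇ`. -/
noncomputable def pairR {a b : ℕ} (z : Ext (R n a)) (w : Ext (R n b)) : Ext (R n (a + b)) :=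
  mkR n _ ((nilP_rep z).append n (nilP_rep w))

lemma pairR_mkR {a b : ℕ} {α : ℝ → Fin a → ℝ} {β : ℝ → Fin b → ℝ} (hα : NilP α) (hβ : NilP β) :
    pairR (mkR n α hα) (mkR n β hβ) = mkR n _ (hα.append n hβ) :=
  mkR_eq_iff.2 (isLittleO_comp (n := n) (g := fun z : (Fin a → ℝ) × (Fin b → ℝ) =>
      Fin.append z.1 z.2) ((nilP_rep _).prodMk (nilP_rep _)) (hα.prodMk hβ)
    ((rep_mkR_sub_isLittleO α hα).prod_left (rep_mkR_sub_isLittleO β hβ))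
    contDiff_append.contDiffAt)

lemma SMor.pairR {a b : ℕ} {f : S → Ext (R n a)} {g : S → Ext (R n b)} (hf : SMor f)
    (hg : SMor g) : SMor (fun x => pairR (f x) (g x)) :=
  hf.map₂ hg contDiff_append fun x α hα β hβ e e' =>
    ⟨hα.append n hβ, by rw [e, e', pairR_mkR]⟩

omit [Fact (1 ≤ n)] in
-- Extension by `0` outside `V` turns an arrow on the subtype into a function on all of `ℝˢ`; its
-- junk values do not affect differentiability at points of the open set `V`.
lemma exists_contDiffAt_eq {V : TopologicalSpace.Opens (Fin s → ℝ)}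
    (h : (Space.bar (OR.of n V)).Hom (R n t)) : ∃ G : (Fin s → ℝ) → Fin t → ℝ,
      (∀ v : V, (show (⊤ : TopologicalSpace.Opens (Fin t → ℝ)) from h v).1 = G v) ∧
      ∀ v ∈ V, ContDiffAt ℝ n G v := by
  let g' : V → Fin t → ℝ := fun v => (show (⊤ : TopologicalSpace.Opens (Fin t → ℝ)) from h v).1
  have hg' : ContMDiff 𝓘(ℝ, Fin s → ℝ) 𝓘(ℝ, Fin t → ℝ) n g' :=
    contMDiff_subtypeVal_comp_iff.2 (h.2 (OR.of n V) id ((OR n).isMor_id _))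
  have hG' : ∀ w : V, Function.extend Subtype.val g' 0 w.1 = g' w :=
    fun w => Subtype.val_injective.extend_apply g' _ w
  refine ⟨Function.extend Subtype.val g' 0, fun v => (hG' v).symm, fun v hv => ?_⟩
  rw [← contMDiffAt_iff_contDiffAt, ← contMDiffAt_subtype_iff (x := (⟨v, hv⟩ : V))]
  exact (congrArg (fun f => ContMDiffAt _ _ _ f _) (funext hG')).mpr (hg' ⟨v, hv⟩)

lemma sMor_of_ext {V : TopologicalSpace.Opens (Fin s → ℝ)}
    (h : (Space.bar (OR.of n V)).Hom (R n t)) {f : S → Ext (R n t)}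
    (hf : ∀ x : S, ∃ y : Ext (Space.bar (OR.of n V)),
      Ext.map (inclR n V) y = x.1 ∧ f x = Ext.map h y) : SMor f := by
  intro b₀ hb₀ hS₀
  obtain ⟨G, hG, hGd⟩ := exists_contDiffAt_eq h
  have key : ∀ (b : ℝ → Fin s → ℝ) (hb : NilP b) (hS : mkR n b hb ∈ S), b 0 ∈ V ∧
      ∃ hc : NilP (fun t => G (b t)), f ⟨_, hS⟩ = mkR n _ hc := by
    intro b hb hS
    obtain ⟨y, hy, e⟩ := hf ⟨_, hS⟩
    obtain ⟨c, hc, hcV, rfl⟩ := exists_mkW y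
    have hbV : b 0 ∈ V := (mkR_mem_extOpen (hc := hb)).1 ⟨_, hy⟩
    refine ⟨hbV, hb.comp (hGd _ hbV), ?_⟩
    obtain ⟨h1, e1⟩ := map_mkW h (hc := hc) (h := hcV)
    obtain ⟨h2, e2⟩ := map_mkW (inclR n V) (hc := hc) (h := hcV)
    have l : (fun t => c t - b t) =o[𝓝 0] (fun t : ℝ => t) :=
      (mkR_eq_iff (hc := hc) (hc' := hb)).1 (e2.symm.trans hy)
    rw [e, e1]
    exact (mkR_eq_iff (hc := h1)).2 ((isLittleO_comp hc hb l (hGd _ (hcV 0))).congr_left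
      fun t => congrArg (· - G (b t)) (hG ⟨c t, hcV t⟩).symm)
  -- No parameter is needed here, so a dummy one, constantly `0` in `ℝ`, fills its place.
  refine ⟨ℝ, inferInstance, inferInstance, inferInstance, fun _ => 0, univ ×ˢ V,
    fun z => G z.2, NilP.const 0, isOpen_univ.prod V.2,
    fun z hz => ((hGd z.2 hz.2).comp z contDiffAt_snd).contDiffWithinAt,
    ⟨trivial, (key b₀ hb₀ hS₀).1⟩, fun b hb hS _ => (key b hb hS).2⟩

/-- Equality in `•V` and in `•ℝˢ` is the same `o(t)` condition on paths. Hence lifts to `•V` of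
points of `extOpen n V` are unique, and chosen lifts can be compared with given ones. -/
lemma map_inclR_injective {V : TopologicalSpace.Opens (Fin s → ℝ)} :
    Function.Injective (Ext.map (inclR n V)) := by
  intro z w e
  obtain ⟨a, ha, haV, rfl⟩ := exists_mkW z
  obtain ⟨b, hb, hbV, rfl⟩ := exists_mkW w
  exact mkW_eq_iff.2 ((mkR_eq_iff (hc := ha) (hc' := hb)).1 e)

lemma SMor.of_comp_ext {r : ℕ} {V : TopologicalSpace.Opens (Fin t → ℝ)}
    (h : (Space.bar (OR.of n V)).Hom (R n r)) {g : S → Ext (R n t)} (hg : SMor g)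
    {f : S → Ext (R n r)}
    (hf : ∀ x : S, ∃ y : Ext (Space.bar (OR.of n V)),
      Ext.map (inclR n V) y = g x ∧ f x = Ext.map h y) : SMor f := by
  choose y hy hfy using hf
  let k : extOpen n V → Ext (R n r) := fun z => Ext.map h z.2.choose
  have hk : SMor k := sMor_of_ext h fun z => ⟨_, z.2.choose_spec, rfl⟩
  have := hk.comp (f := fun x => ⟨g x, ⟨y x, hy x⟩⟩) hg
  refine (congrArg SMor (funext fun x => ?_)).mp this
  refine Eq.trans ?_ (hfy x).symm
  have hz : (⟨y x, hy x⟩ : ∃ y, Ext.map (inclR n V) y = g x).choose = y x :=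
    map_inclR_injective ((⟨y x, hy x⟩ : ∃ y, Ext.map (inclR n V) y = g x).choose_spec.trans (hy x).symm)
  exact congrArg (Ext.map h) hz

/-- The inclusion of an open subset of a subset of an extended real space. -/
def inclS (H : SERObj n) (U : TopologicalSpace.Opens H.2) :
    (Subtype.val '' (U : Set H.2) : Set (Ext (R n H.1))) → H.2 :=
  (SER n).incl H U

lemma inclS_isOpenEmbedding (H : SERObj n) (U : TopologicalSpace.Opens H.2) :
    IsOpenEmbedding (inclS H U) :=
  (SER n).incl_isOpenEmbedding H U

lemma range_inclS (H : SERObj n) (U : TopologicalSpace.Opens H.2) : range (inclS H U) = U :=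
  (SER n).range_incl H U

lemma sMor_inclS (H : SERObj n) (U : TopologicalSpace.Opens H.2) :
    SMor fun x => (inclS H U x).1 :=
  isSERMor_iff_sMor.1 ((SER n).isMor_incl H U)

lemma sMor_of_local {H : SERObj n} {f : H.2 → Ext (R n t)}
    (hf : ∀ x : H.2, ∃ U : TopologicalSpace.Opens H.2, x ∈ U ∧
      SMor fun y : Subtype.val '' (U : Set H.2) => f (inclS H U y)) : SMor f :=
  isSERMor_iff_sMor.1 ((SER n).isMor_sheaf (H := H) (K := (⟨t, univ⟩ : SERObj n))
    (f := fun x => ⟨f x, trivial⟩) fun x => by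
      obtain ⟨U, hx, hU⟩ := hf x
      exact ⟨U, hx, isSERMor_iff_sMor.2 hU⟩)

end SMor

end

section

variable {n : ℕ∞}

/-! ## Charts of `Cⁿ` spaces -/

lemma Ext.map_comp {X : CSpace.{u} n} {Y : CSpace.{v} n} {Z : CSpace n} (g : Y.Hom Z) (f : X.Hom Y)
    (z : Ext X) : Ext.map (g.comp f) z = Ext.map g (Ext.map f z) := by
  induction z using Quotient.inductionOn with
  | h x => rfl

/-- A point of `•X` depends only on the germ of its path at `0`; the neighbourhood filter includes
`t = 0`, so the base points agree as well. -/
lemma Ext.mk_congr {X : CSpace.{u} n} {x y : NilpotentPath X}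
    (h : ∀ᶠ t in 𝓝 0, x.1 t = y.1 t) : Ext.mk x = Ext.mk y := by
  refine Quotient.sound fun U k K c hc => ⟨by rw [h.self_of_nhds], fun _ => ?_⟩
  refine (isLittleO_zero (fun t : ℝ => t) (𝓝 0)).congr' ?_ .rfl
  filter_upwards [h] with t ht
  rw [ht, sub_self]

/-- Applied to the observable of a chart, this makes membership in the chart domain independent of
the representative, without any separation axiom on `X`. -/
lemma Ext.mk_zero_mem_iff {X : CSpace.{u} n} {x y : NilpotentPath X} (h : Ext.mk x = Ext.mk y)
    {U : Set X.carrier} {k : ℕ} {K : TopologicalSpace.Opens (Fin k → ℝ)}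
    {c : X.carrier → Fin k → ℝ} (hc : IsObservable X U K c) : x.1 0 ∈ U ↔ y.1 0 ∈ U :=
  ((Quotient.exact h) U k K c hc).1

/-- A chart of a `Cⁿ` space: a parametrization of an open subset by an open set of `ℝᵈ`, with an
observable as its inverse. -/
structure CChart (X : CSpace.{u} n) where
  d : ℕ
  W : TopologicalSpace.Opens (Fin d → ℝ)
  param : (Space.bar (OR.of n W)).Hom X
  coo : X.carrier → Fin d → ℝ
  isObservable : IsObservable X (range param.1) ⊤ coo
  coo_param : ∀ w : W, coo (param w) = w

/-- Every point of the `Cⁿ` space is in the domain of a chart. -/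
def LocEuclidean (X : CSpace.{u} n) : Prop := ∀ x, ∃ c : CChart X, x ∈ range c.param.1

namespace CChart

variable {X : CSpace.{u} n} (c : CChart X)

/-- The points of `•X` in the domain of the chart. -/
def dom : Set (Ext X) := range (Ext.map c.param)

/-- Testing the equality with the observable `coo`, a left inverse of `param`, recovers the `o(t)`
condition on the parameter paths. -/
lemma map_param_injective [Fact (1 ≤ n)] : Function.Injective (Ext.map c.param) := by
  intro z w e
  obtain ⟨a, ha, haW, rfl⟩ := exists_mkW z
  obtain ⟨b, hb, hbW, rfl⟩ := exists_mkW w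
  have := ((Quotient.exact e) _ _ _ _ c.isObservable).2 ⟨_, rfl⟩
  refine mkW_eq_iff.2 (this.congr_left fun t => ?_)
  exact congrArg₂ (· - ·) (c.coo_param ⟨a t, haW t⟩) (c.coo_param ⟨b t, hbW t⟩)

/-- The domain of a chart is open, so a path starting in it stays there for small `t` and can be
lifted; the lift is nilpotent because `coo` is an observable. -/
lemma mk_mem_dom [Fact (1 ≤ n)] {x : NilpotentPath X} :
    Ext.mk x ∈ c.dom ↔ x.1 0 ∈ range c.param.1 := by
  classical
  constructor
  · rintro ⟨w, hw⟩
    induction w using Quotient.inductionOn with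
    | h w => exact (Ext.mk_zero_mem_iff hw c.isObservable).1 ⟨_, rfl⟩
  · intro h0
    have hev : ∀ᶠ t in 𝓝 0, x.1 t ∈ range c.param.1 :=
      letI := X.topology
      x.2.1 (IsOpen.mem_nhds c.isObservable.1 h0)
    -- Where the path leaves the domain, the parameter of `x 0` serves as a filler; this does not
    -- change the germ at `0`.
    let w : ℝ → c.W := fun t => if h : x.1 t ∈ range c.param.1 then h.choose else h0.choose
    have hw : ∀ᶠ t in 𝓝 0, c.param (w t) = x.1 t := by
      filter_upwards [hev] with t ht
      have : w t = ht.choose := dif_pos ht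
      rw [this]
      exact ht.choose_spec
    have hnil : NilP (fun t => c.coo (x.1 t)) := x.2.2 _ _ _ _ c.isObservable h0
    have hnw : NilP (fun t => (w t : Fin c.d → ℝ)) := by
      refine hnil.congr ?_
      filter_upwards [hw] with t ht
      rw [← ht, c.coo_param]
    exact ⟨Ext.mk ⟨w, isNilpotentPath_iff.2 hnw⟩, Ext.mk_congr hw⟩

lemma exists_mem_dom [Fact (1 ≤ n)] (hX : LocEuclidean X) (z : Ext X) : ∃ c : CChart X, z ∈ c.dom := by
  induction z using Quotient.inductionOn with
  | h x =>
    obtain ⟨c, hc⟩ := hX (x.1 0)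
    exact ⟨c, c.mk_mem_dom.2 hc⟩

open Classical in
/-- The coordinates of a point of `•X` in the domain of a chart. -/
noncomputable def coord [Fact (1 ≤ n)] (z : Ext X) : Ext (R n c.d) :=
  if h : z ∈ c.dom then Ext.map (inclR n c.W) h.choose else 0

variable [Fact (1 ≤ n)]

lemma coord_map_param (w : Ext (Space.bar (OR.of n c.W))) :
    c.coord (Ext.map c.param w) = Ext.map (inclR n c.W) w := by
  have h : Ext.map c.param w ∈ c.dom := ⟨w, rfl⟩
  rw [coord, dif_pos h]
  exact congrArg _ (c.map_param_injective h.choose_spec)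

lemma coord_mem {z : Ext X} (hz : z ∈ c.dom) : c.coord z ∈ extOpen n c.W := by
  obtain ⟨w, rfl⟩ := hz
  rw [coord_map_param]
  exact ⟨w, rfl⟩

lemma coord_injOn : InjOn c.coord c.dom := by
  rintro _ ⟨w, rfl⟩ _ ⟨w', rfl⟩ e
  rw [coord_map_param, coord_map_param] at e
  rw [map_inclR_injective e]

/-- The part of an open set of `ℝᵐ` that a figure maps to the domain of a chart. -/
def preDom {m : ℕ} {V : TopologicalSpace.Opens (Fin m → ℝ)} (h : (Space.bar (OR.of n V)).Hom X) :
    TopologicalSpace.Opens (Fin m → ℝ) :=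
  ⟨Subtype.val '' (h.1 ⁻¹' range c.param.1), V.2.isOpenMap_subtype_val _
    (isOpen_of_topology (h.isOpen_preimage c.isObservable.1))⟩

/-- Both conditions depend only on the value at `0` of a path representing `y`. -/
lemma map_mem_dom_iff {m : ℕ} {V : TopologicalSpace.Opens (Fin m → ℝ)}
    (h : (Space.bar (OR.of n V)).Hom X) (y : Ext (Space.bar (OR.of n V))) :
    Ext.map h y ∈ c.dom ↔ Ext.map (inclR n V) y ∈ extOpen n (c.preDom h) := by
  obtain ⟨b, hb, hbV, rfl⟩ := exists_mkW y
  refine c.mk_mem_dom.trans (Iff.trans ?_ (mkR_mem_extOpen (hc := hb)).symm)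
  constructor
  · intro h0
    exact ⟨⟨b 0, hbV 0⟩, h0, rfl⟩
  · rintro ⟨v, hv, e⟩
    have : v = ⟨b 0, hbV 0⟩ := Subtype.ext e
    exact (congrArg (fun v => h.1 v ∈ range c.param.1) this).mp hv

/-- On `preDom` the figure `h` factors as `param ∘ ψ`. The lift `ψ` is of class `Cⁿ` because it
equals `coo ∘ h` and `coo` is an observable. So reading `•h` in the chart is again the extension of
a `Cⁿ` map. -/
lemma exists_local_coord {m : ℕ} {V : TopologicalSpace.Opens (Fin m → ℝ)}
    (h : (Space.bar (OR.of n V)).Hom X) : ∃ k : (Space.bar (OR.of n (c.preDom h))).Hom (R n c.d),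
      ∀ y : Ext (Space.bar (OR.of n V)), Ext.map h y ∈ c.dom →
        ∃ y', Ext.map (inclR n (c.preDom h)) y' = Ext.map (inclR n V) y ∧
          c.coord (Ext.map h y) = Ext.map k y' := by
  have hV : ∀ v : c.preDom h, v.1 ∈ V := by
    rintro ⟨_, v, _, rfl⟩
    exact v.2
  have hdom : ∀ v : c.preDom h, h (⟨v.1, hV v⟩ : V) ∈ range c.param.1 := by
    rintro ⟨_, v, hv, rfl⟩
    exact hv
  let ι : (Space.bar (OR.of n (c.preDom h))).Hom (Space.bar (OR.of n V)) :=
    OR.hom (W := c.preDom h) (K := V) (fun v => ⟨v.1, hV v⟩) contMDiff_subtype_val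
  choose ψ hψ using hdom
  have hψ' : (Space.bar (OR.of n (c.preDom h))).IsHom (Space.bar (OR.of n c.W)) ψ := by
    intro H d hd
    obtain ⟨-, φ, hφ⟩ := c.isObservable
    have h1 := φ.2 H (fun x => ⟨h (ι (d x)), ψ (d x), hψ (d x)⟩) (h.2 H _ (ι.2 H d hd))
    refine contMDiff_subtypeVal_comp_iff.1 ((congrArg (ContMDiff _ _ _)
      (funext fun x => ?_)).mp (contMDiff_subtypeVal_comp_iff.2 h1))
    refine (hφ _).symm.trans ?_
    exact (congrArg c.coo (hψ (d x)).symm).trans (c.coo_param _)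
  let Ψ : (Space.bar (OR.of n (c.preDom h))).Hom (Space.bar (OR.of n c.W)) := ⟨ψ, hψ'⟩
  refine ⟨(inclR n c.W).comp Ψ, fun y hy => ?_⟩
  obtain ⟨y', hy'⟩ := (c.map_mem_dom_iff h y).1 hy
  have hy1 : Ext.map ι y' = y := map_inclR_injective (by
    rw [← hy', ← Ext.map_comp]
    rfl)
  refine ⟨y', hy', ?_⟩
  have e : Ext.map h y = Ext.map c.param (Ext.map Ψ y') := by
    rw [← hy1, ← Ext.map_comp, ← Ext.map_comp]
    exact congrArg (Ext.map · y') (Subtype.ext (funext fun v => (hψ v).symm))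
  rw [e, coord_map_param, Ext.map_comp]

end CChart

/-! ## Figures of extended spaces in charts -/

variable [Fact (1 ≤ n)] {X : CSpace.{u} n}

lemma extSpace_fig_of_sMor {H : SERObj n} {δ : H.2 → (extSpace X).carrier} {m : ℕ}
    {V : TopologicalSpace.Opens (Fin m → ℝ)} (h : (Space.bar (OR.of n V)).Hom X)
    {g : H.2 → Ext (R n m)} (hg : SMor g)
    (hδ : ∀ x, ∃ y, Ext.map (inclR n V) y = g x ∧ (δ x).1 = Ext.map h y) :
    (extSpace X).fig H δ := by
  intro x₀
  choose y hy hδy using hδ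
  refine ⟨⊤, trivial, (⟨m, extOpen n V⟩ : SERObj n),
    fun z => (⟨Ext.map h z.2.choose, trivial⟩ : (univ : Set (Ext X))),
    Or.inr ⟨V, h, fun z => ⟨z.2.choose, z.2.choose_spec, rfl⟩⟩,
    fun x => ⟨g (inclS H ⊤ x), y _, hy _⟩, ?_, ?_⟩
  · exact isSERMor_iff_sMor.2 (hg.comp (sMor_inclS H ⊤))
  · funext x
    refine Subtype.ext ((hδy _).trans (congrArg (Ext.map h) ?_))
    refine map_inclR_injective ((hy _).trans ?_)
    exact (⟨y (inclS H ⊤ x), hy _⟩ :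
      ∃ w, Ext.map (inclR n V) w = g (inclS H ⊤ x)).choose_spec.symm

/-- This unpacks the generated structure: locally a figure is constant, or it is `•h` after an arrow
`f` of subsets of extended real spaces. -/
lemma extSpace_fig_local {H : SERObj n} {δ : H.2 → (extSpace X).carrier}
    (hδ : (extSpace X).fig H δ) (x₀ : H.2) : ∃ U : TopologicalSpace.Opens H.2, x₀ ∈ U ∧
      ((∃ z, ∀ x, (δ (inclS H U x)).1 = z) ∨
        ∃ (m : ℕ) (V : TopologicalSpace.Opens (Fin m → ℝ)) (h : (Space.bar (OR.of n V)).Hom X)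
          (f : (Subtype.val '' (U : Set H.2) : Set (Ext (R n H.1))) → Ext (R n m)), SMor f ∧
          ∀ x, ∃ y, Ext.map (inclR n V) y = f x ∧ (δ (inclS H U x)).1 = Ext.map h y) := by
  obtain ⟨U, hx, K, d, hd, f, hf, e⟩ := hδ x₀
  refine ⟨U, hx, ?_⟩
  rcases hd with ⟨z, hz⟩ | ⟨V, h, hV⟩
  · exact Or.inl ⟨z.1, fun x => congrArg Subtype.val ((congrFun e x).trans (hz _))⟩
  · refine Or.inr ⟨_, V, h, fun x => (f x).1, isSERMor_iff_sMor.1 hf, fun x => ?_⟩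
    obtain ⟨y, hy, hdy⟩ := hV (f x)
    exact ⟨y, hy, (congrArg Subtype.val (congrFun e x)).trans hdy⟩

namespace CChart

variable (c : CChart X)

/-- In other words, `c.dom` is open in the final topology. Where the figure is locally `•h ∘ f`, the
preimage is `f ⁻¹' extOpen n (c.preDom h)`; where it is constant, the preimage is all or nothing. -/
lemma isOpen_preimage_dom {H : SERObj n} {δ : H.2 → (extSpace X).carrier}
    (hδ : (extSpace X).fig H δ) : IsOpen {x | (δ x).1 ∈ c.dom} := by
  rw [isOpen_iff_forall_mem_open]
  intro x₀ h₀
  obtain ⟨U, hx₀, hU⟩ := extSpace_fig_local hδ x₀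
  have hrange := range_inclS H U
  have hemb := inclS_isOpenEmbedding H U
  obtain ⟨x₀, rfl⟩ : x₀ ∈ range (inclS H U) := by rw [hrange]; exact hx₀
  rcases hU with ⟨z, hz⟩ | ⟨m, V, h, f, hf, hU⟩
  · refine ⟨range (inclS H U), ?_, hemb.isOpen_range, ⟨_, rfl⟩⟩
    rintro _ ⟨x, rfl⟩
    have h₀ : (δ (inclS H U x₀)).1 ∈ c.dom := h₀
    rw [hz] at h₀
    show (δ (inclS H U x)).1 ∈ c.dom
    rw [hz]
    exact h₀
  · have key : ∀ x, (δ (inclS H U x)).1 ∈ c.dom ↔ f x ∈ extOpen n (c.preDom h) := by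
      intro x
      obtain ⟨y, hy, e⟩ := hU x
      rw [e, ← hy, c.map_mem_dom_iff]
    have hfc : Continuous f := continuous_subtype_val.comp
      (isSERMor_iff_sMor (f := fun x => (⟨f x, trivial⟩ : univ)).2 hf).continuous
    refine ⟨inclS H U '' (f ⁻¹' extOpen n (c.preDom h)), ?_,
      hemb.isOpenMap _ ((isOpen_ext_iff.2 ⟨_, rfl⟩).preimage hfc), ⟨x₀, (key x₀).1 h₀, rfl⟩⟩
    rintro _ ⟨x, hx, rfl⟩
    exact (key x).2 hx

/-- Together with `fig_of_sMor_coord` this identifies the figures inside a chart domain with maps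
whose coordinates are arrows, so that sums may be formed in coordinates. -/
lemma sMor_coord {H : SERObj n} {δ : H.2 → (extSpace X).carrier}
    (hδ : (extSpace X).fig H δ) (hdom : ∀ x, (δ x).1 ∈ c.dom) : SMor fun x => c.coord (δ x).1 := by
  refine sMor_of_local fun x₀ => ?_
  obtain ⟨U, hx₀, hU⟩ := extSpace_fig_local hδ x₀
  refine ⟨U, hx₀, ?_⟩
  rcases hU with ⟨z, hz⟩ | ⟨m, V, h, f, hf, hU⟩
  · simp only [hz]
    exact sMor_const _
  · obtain ⟨k, hk⟩ := c.exists_local_coord h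
    refine hf.of_comp_ext k fun x => ?_
    obtain ⟨y, hy, e⟩ := hU x
    have hd := hdom (inclS H U x)
    rw [e] at hd
    obtain ⟨y', hy', e'⟩ := hk y hd
    exact ⟨y', hy'.trans hy, (congrArg c.coord e).trans e'⟩

lemma fig_of_sMor_coord {H : SERObj n} {δ : H.2 → (extSpace X).carrier}
    (hdom : ∀ x, (δ x).1 ∈ c.dom) (h : SMor fun x => c.coord (δ x).1) :
    (extSpace X).fig H δ := by
  refine extSpace_fig_of_sMor c.param h fun x => ?_
  obtain ⟨w, hw⟩ := hdom x
  exact ⟨w, by rw [← hw, coord_map_param], hw.symm⟩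

end CChart

end

section

variable {n : ℕ∞} [Fact (1 ≤ n)]

/-! ## First order infinitesimals -/

section Order

variable {E : Type*} [NormedAddCommGroup E]

/-- The filter `𝓝 0` is not punctured, so the bound `‖b t‖ ≤ C * ‖t‖` holds at `t = 0` itself. -/
lemma isBigO_id_zero {b : ℝ → E} (hb : b =O[𝓝 0] fun t : ℝ => t) : b 0 = 0 := by
  obtain ⟨C, hC⟩ := hb.bound
  simpa using hC.self_of_nhds

lemma nilP_of_isBigO {b : ℝ → E} (hb : b =O[𝓝 0] fun t : ℝ => t) : NilP b := by
  -- The exponent `2` works since `O(t) ^ 2 = O(t ^ 2) = o(t)`.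
  refine ⟨2, ?_⟩
  rw [isBigO_id_zero hb]
  simp only [sub_zero]
  refine (hb.norm_left.pow 2).trans_isLittleO ?_
  simpa using isLittleO_pow_pow (𝕜 := ℝ) one_lt_two

lemma tendsto_zero_of_isBigO {b : ℝ → E} (hb : b =O[𝓝 0] fun t : ℝ => t) :
    Tendsto b (𝓝 0) (𝓝 0) :=
  hb.trans_tendsto tendsto_id

/-- The compared points `(a t, v t)` and `(a t, 0)` both move, but their difference is `O(t)`.
Strict differentiability is what is needed: `a t - a 0` need not be `O(t)`, so plain
differentiability at `(a 0, 0)` would not give an error `o(t)`. -/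
lemma HasStrictFDerivAt.isLittleO_sub_sub {P F : Type*} [NormedAddCommGroup P] [NormedSpace ℝ P]
    [NormedSpace ℝ E] [NormedAddCommGroup F] [NormedSpace ℝ F] {G : P × E → F} {a : ℝ → P}
    {L : P × E →L[ℝ] F} (hG : HasStrictFDerivAt G L (a 0, 0)) (ha : ContinuousAt a 0)
    {v : ℝ → E} (hv : v =O[𝓝 0] fun t : ℝ => t) :
    (fun t => G (a t, v t) - G (a t, 0) - L (0, v t)) =o[𝓝 0] fun t : ℝ => t := by
  have h1 : Tendsto (fun t => ((a t, v t), (a t, (0 : E)))) (𝓝 0) (𝓝 ((a 0, 0), (a 0, 0))) :=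
    (ha.prodMk_nhds (tendsto_zero_of_isBigO hv)).prodMk_nhds (ha.prodMk_nhds tendsto_const_nhds)
  have h2 := hG.isLittleO.comp_tendsto h1
  have h3 : (fun t => (a t, v t) - (a t, (0 : E))) =O[𝓝 0] fun t : ℝ => t := by
    simp only [Prod.mk_sub_mk, sub_self, sub_zero]
    exact (isBigO_zero _ _).prod_left hv
  refine (h2.trans_isBigO h3).congr_left fun t => ?_
  have e : ((0 : P), v t) = (a t, v t) - (a t, 0) := by simp
  rw [e]
  rfl

end Order

lemma mem_firstOrder_iff {z : Ext (R n 1)} : z ∈ firstOrder n ↔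
    ∃ b hb, z = mkR n b hb ∧ b =O[𝓝 0] fun t : ℝ => t := by
  constructor
  · rintro ⟨c, rfl, hc⟩
    exact ⟨_, isNilpotentPath_iff.1 c.2, rfl, hc⟩
  · rintro ⟨b, hb, rfl, hO⟩
    exact ⟨_, rfl, hO⟩

/-- The points of `•ℝᵏ` with coordinates in `D`. -/
def infPow (n : ℕ∞) [Fact (1 ≤ n)] (k : ℕ) : Set (Ext (R n k)) :=
  {z | ∃ b hb, z = mkR n b hb ∧ b =O[𝓝 0] fun t : ℝ => t}

/-- The point of `infPow n k` given by a path. -/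
def mkInf (n : ℕ∞) [Fact (1 ≤ n)] {k : ℕ} {b : ℝ → Fin k → ℝ} (hb : b =O[𝓝 0] fun t : ℝ => t) :
    infPow n k :=
  ⟨mkR n b (nilP_of_isBigO hb), b, _, rfl, hb⟩

lemma isBigO_single {k : ℕ} {b : ℝ → Fin k → ℝ} (hb : b =O[𝓝 0] fun t : ℝ => t) (i : Fin k) :
    (fun t => Pi.single i (b t i) : ℝ → Fin k → ℝ) =O[𝓝 0] fun t : ℝ => t := by
  refine isBigO_pi.2 fun j => ?_
  by_cases h : j = i
  · subst h
    simpa using isBigO_pi.1 hb j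
  · simpa [h] using isBigO_zero _ _

/-- Arrows from `Dᵏ` to `•ℝᵐ` are affine. -/
lemma SMor.eq_add_sum {k m : ℕ} {f : infPow n k → Ext (R n m)} (hf : SMor f) {b : ℝ → Fin k → ℝ}
    (hb : b =O[𝓝 0] fun t : ℝ => t) :
    f (mkInf n hb) = f (mkInf n (isBigO_zero _ _)) +
      ∑ i, (f (mkInf n (isBigO_single hb i)) - f (mkInf n (isBigO_zero _ _))) := by
  obtain ⟨P, _, _, _, a, O, G, ha, hO, hG, h0, hfG⟩ :=
    hf (fun _ => 0) (NilP.const 0) (mkInf n (isBigO_zero _ _)).2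
  -- The local expression of `f` at `0` applies at every point of `infPow n k`, because all first
  -- order paths have value `0` at `t = 0`.
  have key : ∀ {v : ℝ → Fin k → ℝ} (hv : v =O[𝓝 0] fun t : ℝ => t),
      ∃ hc : NilP (fun t => G (a t, v t)), f (mkInf n hv) = mkR n _ hc := fun {v} hv =>
    hfG v (nilP_of_isBigO hv) (mkInf n hv).2 (by rw [isBigO_id_zero hv]; exact h0)
  have hstrict : HasStrictFDerivAt G (fderiv ℝ G (a 0, 0)) (a 0, 0) :=
    (hG.contDiffAt (hO.mem_nhds h0)).hasStrictFDerivAt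
      (by have : 1 ≤ n := Fact.out
          intro h
          have h' : n = 0 := by exact_mod_cast h
          simp [h'] at this)
  have est := fun {v : ℝ → Fin k → ℝ} (hv : v =O[𝓝 0] fun t : ℝ => t) =>
    HasStrictFDerivAt.isLittleO_sub_sub hstrict ha.continuousAt hv
  obtain ⟨hz, ez⟩ := key (isBigO_zero _ _)
  obtain ⟨hc, ec⟩ := key hb
  choose hi ei using fun i => key (isBigO_single hb i)
  rw [ez, ec]
  simp only [ei, mkR_sub]
  obtain ⟨hs, es⟩ := mkR_sum (n := n) Finset.univ fun i => (hi i).sub n hz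
  rw [es, mkR_add, mkR_eq_iff]
  -- The estimate along `b` minus those along its axis components: the linear terms cancel, since `b
  -- t` is the sum of its components, and what remains is the required difference.
  have := (est hb).sub (IsLittleO.sum (s := Finset.univ) fun i _ => est (isBigO_single hb i))
  refine this.congr_left fun t => ?_
  have hL : fderiv ℝ G (a 0, 0) (0, b t) =
      ∑ i, fderiv ℝ G (a 0, 0) (0, Pi.single i (b t i)) := by
    rw [← map_sum]
    congr 1
    refine Prod.ext ?_ ?_
    · simp [Prod.fst_sum]
    · simp [Prod.snd_sum, Finset.univ_sum_single]
  rw [hL, Finset.sum_apply, Finset.sum_sub_distrib, Finset.sum_sub_distrib]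
  abel

/-! ## Figures of `D` -/

omit [Fact (1 ≤ n)] in
lemma Ext.map_id' {X : CSpace.{u} n} (z : Ext X) :
    Ext.map (⟨fun x => x, fun _ _ hd => hd⟩ : X.Hom X) z = z := by
  induction z using Quotient.inductionOn with
  | h x => rfl

lemma isBigO_coord {k : ℕ} {b : ℝ → Fin k → ℝ} (hb : b =O[𝓝 0] fun t : ℝ => t) (i : Fin k) :
    (fun t (_ : Fin 1) => b t i) =O[𝓝 0] fun t : ℝ => t :=
  isBigO_pi.2 fun _ => isBigO_pi.1 hb i

/-- For the converse, the identity of `ℝ` is a figure, so the identity of the subset `firstOrder n`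
is a generating figure of `D`. -/
lemma D_fig_iff {H : SERObj n} {δ : H.2 → firstOrder n} :
    (D n).fig H δ ↔ SMor fun x => (δ x).1 := by
  constructor
  · intro hδ
    refine sMor_of_local fun x₀ => ?_
    obtain ⟨U, hx, K, d, hd, f, hf, e⟩ := hδ x₀
    refine ⟨U, hx, ?_⟩
    have e' : ∀ x, δ (inclS H U x) = d (f x) := congrFun e
    rcases hd with ⟨z, hz⟩ | ⟨V, h, hV⟩
    · have : (fun x => (δ (inclS H U x)).1) = fun _ => z.1 := funext fun x =>
        congrArg Subtype.val ((e' x).trans (hz _))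
      rw [this]
      exact sMor_const _
    · refine (isSERMor_iff_sMor.1 hf).of_comp_ext h fun x => ?_
      obtain ⟨y, hy, hdy⟩ := hV (f x)
      exact ⟨y, hy, (congrArg Subtype.val (e' x)).trans hdy⟩
  · intro hδ x₀
    refine ⟨⊤, trivial, (⟨1, firstOrder n⟩ : SERObj n), id,
      Or.inr ⟨⊤, ⟨fun x => x, fun _ _ hd => hd⟩, fun x => ⟨x.1, Ext.map_id' _, (Ext.map_id' _).symm⟩⟩,
      fun x => δ (inclS H ⊤ x), isSERMor_iff_sMor.2 (hδ.comp (sMor_inclS H ⊤)), rfl⟩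

/-- The `i`-th coordinate `•ℝᵏ → •ℝ`. -/
def evR (n : ℕ∞) {k : ℕ} (i : Fin k) : (R n k).Hom (R n 1) :=
  OR.hom (W := ⊤) (K := ⊤) (fun w => ⟨fun _ => w.1 i, trivial⟩)
    (ContMDiff.comp (g := fun (w : Fin k → ℝ) (_ : Fin 1) => w i)
      (ContDiff.contMDiff (by fun_prop)) contMDiff_subtype_val)

/-- The coordinates of a point of `infPow n k`. -/
def infCoord {k : ℕ} (z : infPow n k) (i : Fin k) : (D n).carrier :=
  show firstOrder n from ⟨Ext.map (evR n i) z.1, by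
    obtain ⟨_, b, hb, rfl, hO⟩ := z
    exact mem_firstOrder_iff.2 ⟨_, nilP_of_isBigO (isBigO_coord hO i), rfl, isBigO_coord hO i⟩⟩

lemma infCoord_mkInf {k : ℕ} {b : ℝ → Fin k → ℝ} (hb : b =O[𝓝 0] fun t : ℝ => t) (i : Fin k) :
    (show firstOrder n from infCoord (mkInf n hb) i).1 =
      mkR n _ (nilP_of_isBigO (isBigO_coord hb i)) :=
  rfl

lemma sMor_map {m k : ℕ} {S : Set (Ext (R n m))} (f : (R n m).Hom (R n k)) :
    SMor fun x : S => Ext.map f x.1 :=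
  sMor_of_ext f fun x => ⟨x.1, by
    obtain ⟨b, hb, e⟩ := exists_mkR x.1
    rw [e]
    rfl, rfl⟩

/-- An arrow out of the power `Dᵏ` is studied by pulling it back along this single figure, which
reaches every point by `exists_mkInf`. -/
lemma fig_infCoord (k : ℕ) :
    ((D n).pow k).fig (⟨k, infPow n k⟩ : SERObj n) (fun z : infPow n k => infCoord z) := fun i =>
  D_fig_iff.2 (sMor_map (evR n i))

lemma infCoord_single {k : ℕ} {b : ℝ → Fin k → ℝ} (hb : b =O[𝓝 0] fun t : ℝ => t) (i : Fin k) :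
    infCoord (mkInf n (isBigO_single hb i)) =
      Function.update (fun _ => D.zero n) i (infCoord (mkInf n hb) i) := by
  funext j
  refine Subtype.ext ((infCoord_mkInf _ j).trans ?_)
  by_cases h : j = i
  · subst h
    rw [Function.update_self, infCoord_mkInf]
    exact mkR_ext fun t => by simp
  · rw [Function.update_of_ne h]
    exact mkR_ext (hb := NilP.const 0) fun t => by simp [h]; rfl

lemma exists_mkInf {k : ℕ} (d : Fin k → (D n).carrier) :
    ∃ (b : ℝ → Fin k → ℝ) (hb : b =O[𝓝 0] fun t : ℝ => t), d = infCoord (mkInf n hb) := by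
  choose β hβ e hO using fun i => mem_firstOrder_iff.1 (show firstOrder n from d i).2
  have hb : (fun t i => β i t 0) =O[𝓝 0] fun t : ℝ => t :=
    isBigO_pi.2 fun i => isBigO_pi.1 (hO i) 0
  refine ⟨_, hb, funext fun i => Subtype.ext ((e i).trans ?_)⟩
  refine (mkR_ext fun t => ?_).trans (infCoord_mkInf hb i).symm
  funext j
  rw [Subsingleton.elim j 0]

/-! ## Infinitesimal linearity of extensions of locally Euclidean spaces -/

variable {X : CSpace.{u} n}

/-- Open sets are cut out by a condition on the value of a path at `0`, and this value is `0` for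
all points of `infPow n k`. -/
lemma mem_of_isOpen_infPow {k : ℕ} {O : Set (infPow n k)} (hO : IsOpen O)
    (h0 : mkInf n (isBigO_zero _ _) ∈ O) (z : infPow n k) : z ∈ O := by
  obtain ⟨V, rfl⟩ := isOpen_subtype_iff.1 hO
  have h1 := (mkR_mem_extOpen (hc := nilP_of_isBigO (isBigO_zero _ _))).1 h0
  obtain ⟨_, b, hb, rfl, hO⟩ := z
  refine (mkR_mem_extOpen (hc := hb)).2 ?_
  rw [isBigO_id_zero hO]
  exact h1

lemma CChart.mem_dom_of_infPow (c : CChart X) {k : ℕ} {δ : infPow n k → (extSpace X).carrier}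
    (hδ : (extSpace X).fig (⟨k, infPow n k⟩ : SERObj n) δ)
    (h0 : (δ (mkInf n (isBigO_zero _ _))).1 ∈ c.dom) (z : infPow n k) : (δ z).1 ∈ c.dom :=
  mem_of_isOpen_infPow (c.isOpen_preimage_dom hδ) h0 z

/-- One chart around the image of `0` therefore suffices to describe the whole arrow. -/
lemma CChart.mem_dom_of_hom (c : CChart X) {k : ℕ} (p : ((D n).pow k).Hom (extSpace X))
    (h0 : (p fun _ => D.zero n).1 ∈ c.dom) (d : Fin k → (D n).carrier) : (p d).1 ∈ c.dom := by
  obtain ⟨b, hb, rfl⟩ := exists_mkInf d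
  exact c.mem_dom_of_infPow (p.2 _ _ (fig_infCoord k)) h0 (mkInf n hb)

/-- In a chart, an arrow `Dᵏ → •X` is the sum of its restrictions to the axes. -/
lemma CChart.coord_hom_eq (c : CChart X) {k : ℕ} (p : ((D n).pow k).Hom (extSpace X))
    (h0 : (p fun _ => D.zero n).1 ∈ c.dom) (d : Fin k → (D n).carrier) :
    c.coord (p d).1 = c.coord (p fun _ => D.zero n).1 +
      ∑ i, (c.coord (p (Function.update (fun _ => D.zero n) i (d i))).1 -
        c.coord (p fun _ => D.zero n).1) := by
  obtain ⟨b, hb, rfl⟩ := exists_mkInf d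
  have hfig := p.2 _ _ (fig_infCoord (n := n) k)
  have := SMor.eq_add_sum (c.sMor_coord hfig (c.mem_dom_of_infPow hfig h0)) hb
  refine this.trans ?_
  congr 1
  refine Finset.sum_congr rfl fun i _ => ?_
  congr 1
  exact congrArg (fun d => c.coord (p d).1) (infCoord_single hb i)

end

section

/-! ## Exponentials -/

section Exp

variable {F : FigCat} {X : Space.{u} F} {Y : Space.{v} F} {Z : Space F}

/-- Evaluation at a point, as an arrow of the cartesian closure. -/
def Space.evalHom (Z : Space F) (y : Y.carrier) : (Y.exp Z).Hom Z :=
  ⟨fun f => f.1 y, fun H _ hd => hd H (fun h => (h, y)) ⟨F.isMor_id H, Y.fig_const H y⟩⟩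

/-- The transpose of an arrow `X × Y → Z`. -/
def Space.curry (f : (X.prod Y).Hom Z) : X.Hom (Y.exp Z) :=
  ⟨fun x => ⟨fun y => f (x, y), fun H d hd => f.2 H (fun h => (x, d h)) ⟨X.fig_const H x, hd⟩⟩,
    fun _ d hd K e he => f.2 K (fun k => (d (e k).1, (e k).2)) ⟨X.fig_comp he.1 hd, he.2⟩⟩

/-- Figures of an exponential, evaluated along a figure of the exponent. -/
lemma Space.fig_eval {H : F.Obj} {d : F.carrier H → (Y.exp Z).carrier} (hd : (Y.exp Z).fig H d)
    {e : F.carrier H → Y.carrier} (he : Y.fig H e) : Z.fig H fun h => (d h).1 (e h) :=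
  hd H (fun h => (h, e h)) ⟨F.isMor_id H, he⟩

end Exp

variable {n : ℕ∞} [Fact (1 ≤ n)] {X : CSpace.{u} n}

/-! ## Infinitesimal linearity -/

lemma CChart.mem_dom_of_tangent (c : CChart X) (t : (D n).Hom (extSpace X))
    (h0 : (t (D.zero n)).1 ∈ c.dom) (d : (D n).carrier) : (t d).1 ∈ c.dom :=
  c.mem_dom_of_hom (k := 1) (t.comp ⟨fun v => v 0, fun _ _ hd => hd 0⟩) h0 fun _ => d

/-- `CChart.coord_hom_eq` recovers an arrow from its values on the axes. The bound on `k` serves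
only to provide an axis, which carries the value at `0`. -/
lemma hom_pow_ext (hX : LocEuclidean X) {k : ℕ} (hk : 1 < k)
    {p q : ((D n).pow k).Hom (extSpace X)}
    (h : ∀ i d, p (Function.update (fun _ => D.zero n) i d) =
      q (Function.update (fun _ => D.zero n) i d)) : p = q := by
  have h0 : p (fun _ => D.zero n) = q fun _ => D.zero n := by
    have := h ⟨0, by omega⟩ (D.zero n)
    rwa [Function.update_eq_self] at this
  obtain ⟨c, hc⟩ := CChart.exists_mem_dom hX (p fun _ => D.zero n).1
  refine Subtype.ext (funext fun d => Subtype.ext ?_)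
  refine c.coord_injOn (c.mem_dom_of_hom p hc d) (c.mem_dom_of_hom q (h0 ▸ hc) d) ?_
  refine (c.coord_hom_eq p hc d).trans (Eq.trans ?_ (c.coord_hom_eq q (h0 ▸ hc) d).symm)
  simp only [h, h0]

/-- The affine formula forced by uniqueness is taken as the definition of the arrow, in a chart
around `x`. -/
lemma exists_hom_pow (hX : LocEuclidean X) {k : ℕ} {x : (extSpace X).carrier}
    (t : Fin k → (D n).Hom (extSpace X)) (ht : ∀ i, t i (D.zero n) = x) :
    ∃ p : ((D n).pow k).Hom (extSpace X), ∀ i d,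
      p (Function.update (fun _ => D.zero n) i d) = t i d := by
  obtain ⟨c, hc⟩ := CChart.exists_mem_dom hX x.1
  have htc : ∀ i d, (t i d).1 ∈ c.dom := fun i d =>
    c.mem_dom_of_tangent (t i) (by rw [ht]; exact hc) d
  let Q : (Fin k → (D n).carrier) → Ext (R n c.d) := fun d =>
    c.coord x.1 + ∑ i, (c.coord (t i (d i)).1 - c.coord x.1)
  have hQ : ∀ {H : SERObj n} {δ : H.2 → Fin k → (D n).carrier}, ((D n).pow k).fig H δ →
      SMor fun x => Q (δ x) := fun {H δ} hδ =>
    (sMor_const _).add (SMor.sum _ fun i =>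
      (c.sMor_coord ((t i).2 H _ (hδ i)) fun _ => htc i _).sub (sMor_const _))
  -- On the `i`-th axis the other summands vanish because `t j 0 = x`.
  have hQaxis : ∀ i d, Q (Function.update (fun _ => D.zero n) i d) = c.coord (t i d).1 := by
    intro i d
    simp only [Q]
    rw [Finset.sum_eq_single_of_mem i (Finset.mem_univ i), Function.update_self]
    · abel
    · intro j _ hj
      rw [Function.update_of_ne hj, ht, sub_self]
  -- The sum of coordinates must stay in `•W` to define a point of `•X`: it does at `0`, where it is
  -- `c.coord x.1`, hence on all of `Dᵏ` by continuity.
  have hQW : ∀ d, Q d ∈ extOpen n c.W := by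
    intro d
    obtain ⟨b, hb, rfl⟩ := exists_mkInf d
    have hcont := (isSERMor_iff_sMor (f := fun z : infPow n k => (⟨Q (infCoord z), trivial⟩ : univ)
      )).2 (hQ (fig_infCoord k)) |>.continuous
    refine mem_of_isOpen_infPow (((isOpen_ext_iff (n := n)).2 ⟨c.W, rfl⟩).preimage
      (continuous_subtype_val.comp hcont)) ?_ (mkInf n hb)
    show Q (fun _ => D.zero n) ∈ extOpen n c.W
    simp only [Q, ht, sub_self, Finset.sum_const_zero, add_zero]
    exact c.coord_mem hc
  choose w hw using hQW
  refine ⟨⟨fun d => (Ext.map c.param (w d)).toSpace, fun H δ hδ =>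
    extSpace_fig_of_sMor c.param (hQ hδ) fun x => ⟨_, hw _, rfl⟩⟩, fun i d => Subtype.ext ?_⟩
  refine c.coord_injOn ⟨_, rfl⟩ (htc i d) ?_
  exact (c.coord_map_param _).trans ((hw _).trans (hQaxis i d))

theorem infLinear_extSpace (hX : LocEuclidean X) : InfLinear (extSpace X) := by
  intro k hk x t ht
  obtain ⟨p, hp⟩ := exists_hom_pow hX t ht
  exact ⟨p, hp, fun q hq => hom_pow_ext hX hk fun i d => (hq i d).trans (hp i d).symm⟩

/-- Existence and uniqueness hold for each `a : A` separately. What remains is that the separately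
chosen arrows `p a` form a joint arrow on `Dᵏ × A`; by transposition this is an arrow `Dᵏ → (•X)^A`.
-/
theorem infLinear_exp (hX : LocEuclidean X) (A : ECSpace.{v} n) :
    InfLinear (A.exp (extSpace X)) := by
  intro k hk f t ht
  have ht' : ∀ a i, ((Space.evalHom (extSpace X) a).comp (t i)) (D.zero n) = f.1 a := fun a i =>
    congrArg (fun g : A.Hom (extSpace X) => g.1 a) (ht i)
  choose p hp using fun a => exists_hom_pow hX (fun i => (Space.evalHom (extSpace X) a).comp (t i))
    (ht' a)
  have hp0 : ∀ a, p a (fun _ => D.zero n) = f.1 a := fun a => by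
    have := (hp a ⟨0, by omega⟩ (D.zero n)).trans (ht' a _)
    rwa [Function.update_eq_self] at this
  have hhom : (((D n).pow k).prod A).IsHom (extSpace X) fun z => p z.2 z.1 := by
    rintro H δ ⟨hα, he⟩
    refine (extSpace X).fig_sheaf H _ fun x₀ => ?_
    obtain ⟨c, hc⟩ := CChart.exists_mem_dom hX (f.1 (δ x₀).2).1
    have hfe : (extSpace X).fig H fun x => f.1 (δ x).2 := f.2 H _ he
    -- Being a figure is local. On the open set where the base value `f a` lies in the chart domain,
    -- so do all values `p a d`, as `p a 0 = f a`.
    refine ⟨⟨_, c.isOpen_preimage_dom hfe⟩, hc, ?_⟩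
    generalize hU : (⟨_, c.isOpen_preimage_dom hfe⟩ : TopologicalSpace.Opens ((SER n).carrier H)) = U
    have hUc : ∀ x, (f.1 (δ ((SER n).incl H U x)).2).1 ∈ c.dom := fun x => by
      have : (SER n).incl H U x ∈ (U : Set _) := by
        rw [← (SER n).range_incl]; exact ⟨x, rfl⟩
      have hset : (U : Set _) = {x | (f.1 (δ x).2).1 ∈ c.dom} := hU ▸ rfl
      rw [hset] at this
      exact this
    have hfe' := (extSpace X).fig_comp ((SER n).isMor_incl H U) hfe
    have hdom : ∀ x d, (p (δ ((SER n).incl H U x)).2 d).1 ∈ c.dom := fun x d =>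
      c.mem_dom_of_hom _ (by rw [hp0]; exact hUc x) d
    have ht2 : ∀ i, (extSpace X).fig _
        ((fun x => (t i ((δ x).1 i)).1 (δ x).2) ∘ (SER n).incl H U) := fun i =>
      (extSpace X).fig_comp ((SER n).isMor_incl H U)
        (Space.fig_eval ((t i).2 H (fun x => (δ x).1 i) (hα i)) he)
    have htd : ∀ i x, ((t i ((δ ((SER n).incl H U x)).1 i)).1 (δ ((SER n).incl H U x)).2).1 ∈
        c.dom := fun i x => by
      have := hdom x (Function.update (fun _ => D.zero n) i ((δ ((SER n).incl H U x)).1 i))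
      rw [hp] at this
      exact this
    refine c.fig_of_sMor_coord (fun x => hdom x _) ?_
    -- The affine formula writes the coordinates of `p a d` through `f` and the `t i` alone, whose
    -- joint dependence on `(d, a)` is already known.
    refine (congrArg SMor (funext fun x => ?_)).mp ((c.sMor_coord hfe' hUc).add
      (SMor.sum Finset.univ fun i => (c.sMor_coord (ht2 i) (htd i)).sub (c.sMor_coord hfe' hUc)))
    refine Eq.trans ?_ (c.coord_hom_eq (p (δ ((SER n).incl H U x)).2)
      (by rw [hp0]; exact hUc x) (δ ((SER n).incl H U x)).1).symm
    rw [hp0]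
    simp only [hp]
    rfl
  refine ⟨Space.curry ⟨_, hhom⟩, fun i d => Subtype.ext (funext fun a => hp a i d), fun q hq => ?_⟩
  refine Subtype.ext (funext fun d => Subtype.ext (funext fun a => ?_))
  have : (Space.evalHom (extSpace X) a).comp q = p a := hom_pow_ext hX hk fun i d =>
    (congrArg (fun g : A.Hom (extSpace X) => g.1 a) (hq i d)).trans (hp a i d).symm
  exact congrArg (fun g : ((D n).pow k).Hom (extSpace X) => g.1 d) this

lemma InfLinear.of_iso {Y Z : ECSpace.{u} n} (φ : Y.Iso Z) (hZ : InfLinear Z) : InfLinear Y := by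
  intro k hk x t ht
  obtain ⟨p, hp, huniq⟩ := hZ k hk (φ.hom x) (fun i => φ.hom.comp (t i))
    fun i => congrArg φ.hom.1 (ht i)
  refine ⟨φ.inv.comp p, fun i d => ?_, fun q hq => ?_⟩
  · exact (congrArg φ.inv.1 (hp i d)).trans (φ.inv_hom _)
  · have := huniq (φ.hom.comp q) fun i d => congrArg φ.hom.1 (hq i d)
    rw [← this]
    exact Subtype.ext (funext fun d => (φ.inv_hom _).symm)

end

section

variable {n : ℕ∞}

/-! ## Charts of manifolds -/

/-- A chart of the atlas is followed by linear coordinates on the model space. Its source is open in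
the final topology because figures are continuous, so the chart map is an observable. -/
lemma Man.locEuclidean (M : Man.{u} n) : LocEuclidean M.toCSpace := by
  intro (x : M.carrier)
  let e : M.E ≃L[ℝ] (Fin (Module.finrank ℝ M.E) → ℝ) := (Module.finBasis ℝ M.E).equivFunL
  let ch := chartAt M.E x
  let W : TopologicalSpace.Opens (Fin (Module.finrank ℝ M.E) → ℝ) :=
    ⟨e.symm ⁻¹' ch.target, ch.open_target.preimage e.symm.continuous⟩
  have hparam : (Space.bar (OR.of n W)).IsHom M.toCSpace fun w : W => ch.symm (e.symm w) := by
    intro (H : ORObj) (d : H.2 → W) hd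
    have h1 : ContMDiff 𝓘(ℝ, Fin H.1 → ℝ) 𝓘(ℝ, Fin (Module.finrank ℝ M.E) → ℝ) n
        (fun x => (d x : Fin (Module.finrank ℝ M.E) → ℝ)) := contMDiff_subtypeVal_comp_iff.2 hd
    have h2 : ContMDiff 𝓘(ℝ, Fin H.1 → ℝ) 𝓘(ℝ, M.E) n (fun x => e.symm (d x).1) :=
      e.symm.contDiff.contMDiff.comp h1
    exact (contMDiffOn_chart_symm (I := 𝓘(ℝ, M.E)) (n := n) (x := x)).comp_contMDiff h2
      fun y => (d y).2
  have hrange : range (fun w : W => ch.symm (e.symm w)) = ch.source := by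
    ext y
    constructor
    · rintro ⟨w, rfl⟩
      exact ch.map_target w.2
    · intro hy
      refine ⟨⟨e (ch y), ?_⟩, ?_⟩
      · show e.symm (e (ch y)) ∈ ch.target
        rw [e.symm_apply_apply]
        exact ch.map_source hy
      · show ch.symm (e.symm (e (ch y))) = y
        rw [e.symm_apply_apply]
        exact ch.left_inv hy
  have hobs : IsObservable M.toCSpace ch.source ⊤ (fun y => e (ch y)) := by
    refine ⟨fun H d hd => ch.open_source.preimage (ContMDiff.continuous hd),
      ⟨fun u => ⟨e (ch u.1), trivial⟩, fun H d hd => ?_⟩, fun _ => rfl⟩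
    refine contMDiff_subtypeVal_comp_iff.1 (e.contDiff.contMDiff.comp ?_)
    exact (contMDiffOn_chart (I := 𝓘(ℝ, M.E)) (n := n) (x := x)).comp_contMDiff hd
      fun y => (d y).2
  refine ⟨⟨_, W, ⟨_, hparam⟩, fun y => e (ch y),
    (congrArg (fun U => IsObservable M.toCSpace U ⊤ _) hrange).mpr hobs, fun w => ?_⟩, ?_⟩
  · show e (ch (ch.symm (e.symm w))) = w
    rw [ch.right_inv w.2, e.apply_symm_apply]
  · show x ∈ range fun w : W => ch.symm (e.symm w)
    rw [hrange]
    exact mem_chart_source M.E x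

/-! ## Products of manifolds -/

lemma Man.isFig_prod_mk (M N : Man.{u} n) {H : ORObj} {d : H.2 → M.carrier × N.carrier}
    (h₁ : M.IsFig H fun x => (d x).1) (h₂ : N.IsFig H fun x => (d x).2) :
    (M.prod N).IsFig H d := by
  have h : ContMDiff 𝓘(ℝ, Fin H.1 → ℝ) (𝓘(ℝ, M.E).prod 𝓘(ℝ, N.E)) n d :=
    ContMDiff.prodMk h₁ h₂
  rw [← modelWithCornersSelf_prod] at h
  exact h

section ProdOpen

variable {m k : ℕ} (U : TopologicalSpace.Opens (Fin m → ℝ)) (V : TopologicalSpace.Opens (Fin k → ℝ))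

/-- The projection `U × V → U`. -/
def prodFst (n : ℕ∞) : (Space.bar (OR.of n (prodOpen U V))).Hom (Space.bar (OR.of n U)) :=
  OR.hom (fun w => ⟨fun i => w.1 (Fin.castAdd k i), w.2.1⟩)
    (ContMDiff.comp (g := fun (w : Fin (m + k) → ℝ) (i : Fin m) => w (Fin.castAdd k i))
      (ContDiff.contMDiff (by fun_prop)) contMDiff_subtype_val)

/-- The projection `U × V → V`. -/
def prodSnd (n : ℕ∞) : (Space.bar (OR.of n (prodOpen U V))).Hom (Space.bar (OR.of n V)) :=
  OR.hom (fun w => ⟨fun i => w.1 (Fin.natAdd m i), w.2.2⟩)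
    (ContMDiff.comp (g := fun (w : Fin (m + k) → ℝ) (i : Fin k) => w (Fin.natAdd m i))
      (ContDiff.contMDiff (by fun_prop)) contMDiff_subtype_val)

variable {U V}

lemma exists_prodOpen (u : U) (v : V) :
    ∃ w : prodOpen U V, prodFst U V n w = u ∧ prodSnd U V n w = v := by
  have hL : (fun i => Fin.append u.1 v.1 (Fin.castAdd k i)) = u.1 := by simp
  have hR : (fun i => Fin.append u.1 v.1 (Fin.natAdd m i)) = v.1 := by simp
  exact ⟨⟨Fin.append u.1 v.1, (congrArg (· ∈ U) hL).mpr u.2, (congrArg (· ∈ V) hR).mpr v.2⟩,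
    Subtype.ext hL, Subtype.ext hR⟩

end ProdOpen

/-- The product of two charts. -/
noncomputable def CChart.prod {M N : Man.{u} n} (c : CChart M.toCSpace) (c' : CChart N.toCSpace) :
    CChart (M.prod N).toCSpace where
  d := c.d + c'.d
  W := prodOpen c.W c'.W
  param := ⟨fun w => (c.param (prodFst c.W c'.W n w), c'.param (prodSnd c.W c'.W n w)),
    fun H d hd => M.isFig_prod_mk N ((c.param.comp (prodFst c.W c'.W n)).2 H d hd)
      ((c'.param.comp (prodSnd c.W c'.W n)).2 H d hd)⟩
  coo z := Fin.append (c.coo z.1) (c'.coo z.2)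
  isObservable := by
    obtain ⟨h1, φ, hφ⟩ := c.isObservable.comp (M.fst N)
    obtain ⟨h2, φ', hφ'⟩ := c'.isObservable.comp (M.snd N)
    have hr : ∀ z ∈ range fun w : prodOpen c.W c'.W =>
        (c.param (prodFst c.W c'.W n w), c'.param (prodSnd c.W c'.W n w)),
        z.1 ∈ range c.param.1 ∧ z.2 ∈ range c'.param.1 := by
      rintro _ ⟨w, rfl⟩
      exact ⟨⟨_, rfl⟩, ⟨_, rfl⟩⟩
    refine ⟨?_, ⟨fun u => ⟨Fin.append (c.coo u.1.1) (c'.coo u.1.2), trivial⟩, ?_⟩, fun _ => rfl⟩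
    -- The range of the product parametrization is the intersection of the preimages of the two
    -- chart domains under the projections.
    · let := (M.prod N).toCSpace.topology
      convert IsOpen.inter h1 h2 using 1
      refine Subset.antisymm hr ?_
      rintro ⟨x, y⟩ ⟨⟨w, hw⟩, ⟨w', hw'⟩⟩
      obtain ⟨v, hv, hv'⟩ := exists_prodOpen (n := n) w w'
      exact ⟨v, Prod.ext ((congrArg c.param.1 hv).trans hw) ((congrArg c'.param.1 hv').trans hw')⟩
    · intro H d hd
      have e1 := φ.2 H (fun h => ⟨(d h).1, (hr _ (d h).2).1⟩) hd
      have e2 := φ'.2 H (fun h => ⟨(d h).1, (hr _ (d h).2).2⟩) hd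
      refine contMDiff_subtypeVal_comp_iff.1 ?_
      have := (contDiff_append (n := n)).contMDiff.comp
        ((contMDiff_subtypeVal_comp_iff.2 e1).prodMk_space (contMDiff_subtypeVal_comp_iff.2 e2))
      refine (congrArg (ContMDiff _ _ _) (funext fun h => ?_)).mp this
      exact congrArg₂ Fin.append (hφ ⟨(d h).1, (hr _ (d h).2).1⟩).symm
        (hφ' ⟨(d h).1, (hr _ (d h).2).2⟩).symm
  coo_param w := by
    refine (congrArg₂ Fin.append (c.coo_param _) (c'.coo_param _)).trans ?_
    exact Fin.append_castAdd_natAdd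

/-! ### The extension preserves products of manifolds -/

section Prod

variable [Fact (1 ≤ n)] {M N : Man.{u} n} (c : CChart M.toCSpace) (c' : CChart N.toCSpace)

omit [Fact (1 ≤ n)] in
lemma Ext.fst_prod_param (w : Ext (Space.bar (OR.of n (prodOpen c.W c'.W)))) :
    Ext.map (M.fst N) (Ext.map (c.prod c').param w) =
      Ext.map c.param (Ext.map (prodFst c.W c'.W n) w) :=
  (Ext.map_comp (M.fst N) (c.prod c').param w).symm.trans
    (Ext.map_comp c.param (prodFst c.W c'.W n) w)

omit [Fact (1 ≤ n)] in
lemma Ext.snd_prod_param (w : Ext (Space.bar (OR.of n (prodOpen c.W c'.W)))) :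
    Ext.map (M.snd N) (Ext.map (c.prod c').param w) =
      Ext.map c'.param (Ext.map (prodSnd c.W c'.W n) w) :=
  (Ext.map_comp (M.snd N) (c.prod c').param w).symm.trans
    (Ext.map_comp c'.param (prodSnd c.W c'.W n) w)

lemma exists_mkW_prod {m k : ℕ} {U : TopologicalSpace.Opens (Fin m → ℝ)}
    {V : TopologicalSpace.Opens (Fin k → ℝ)} (z : Ext (Space.bar (OR.of n U)))
    (w : Ext (Space.bar (OR.of n V))) : ∃ y : Ext (Space.bar (OR.of n (prodOpen U V))),
      Ext.map (prodFst U V n) y = z ∧ Ext.map (prodSnd U V n) y = w := by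
  obtain ⟨a, ha, haU, rfl⟩ := exists_mkW z
  obtain ⟨b, hb, hbV, rfl⟩ := exists_mkW w
  have hL : ∀ t, (fun i => Fin.append (a t) (b t) (Fin.castAdd k i)) = a t := fun t => by simp
  have hR : ∀ t, (fun i => Fin.append (a t) (b t) (Fin.natAdd m i)) = b t := fun t => by simp
  refine ⟨mkW n _ _ (ha.append n hb) fun t => ⟨(congrArg (· ∈ U) (hL t)).mpr (haU t),
    (congrArg (· ∈ V) (hR t)).mpr (hbV t)⟩, ?_, ?_⟩
  · exact Ext.mk_congr (Eventually.of_forall fun t => Subtype.ext (hL t))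
  · exact Ext.mk_congr (Eventually.of_forall fun t => Subtype.ext (hR t))

lemma pairR_map_prod {m k : ℕ} {U : TopologicalSpace.Opens (Fin m → ℝ)}
    {V : TopologicalSpace.Opens (Fin k → ℝ)} (y : Ext (Space.bar (OR.of n (prodOpen U V)))) :
    pairR (Ext.map (inclR n U) (Ext.map (prodFst U V n) y))
      (Ext.map (inclR n V) (Ext.map (prodSnd U V n) y)) = Ext.map (inclR n (prodOpen U V)) y := by
  obtain ⟨b, hb, hbU, rfl⟩ := exists_mkW y
  obtain ⟨h1, e1⟩ := map_mkW ((inclR n U).comp (prodFst U V n)) (hc := hb) (h := hbU)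
  obtain ⟨h2, e2⟩ := map_mkW ((inclR n V).comp (prodSnd U V n)) (hc := hb) (h := hbU)
  rw [← Ext.map_comp, ← Ext.map_comp, e1, e2]
  refine (pairR_mkR h1 h2).trans (mkR_ext (hb := hb) fun t => ?_)
  exact Fin.append_castAdd_natAdd

/-- By `mk_mem_dom` only the base point of a representing path matters, and it can be tested on each
factor. -/
lemma CChart.mem_dom_prod {z : Ext (M.prod N).toCSpace}
    (h : Ext.map (M.fst N) z ∈ c.dom) (h' : Ext.map (M.snd N) z ∈ c'.dom) :
    z ∈ (c.prod c').dom := by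
  induction z using Quotient.inductionOn with
  | h x =>
    obtain ⟨w, hw⟩ := c.mk_mem_dom.1 h
    obtain ⟨w', hw'⟩ := c'.mk_mem_dom.1 h'
    refine (c.prod c').mk_mem_dom.2 ?_
    obtain ⟨v, hv, hv'⟩ := exists_prodOpen (n := n) w w'
    exact ⟨v, Prod.ext ((congrArg c.param.1 hv).trans hw) ((congrArg c'.param.1 hv').trans hw')⟩

lemma CChart.coord_prod {z : Ext (M.prod N).toCSpace} (hz : z ∈ (c.prod c').dom) :
    (c.prod c').coord z =
      pairR (c.coord (Ext.map (M.fst N) z)) (c'.coord (Ext.map (M.snd N) z)) := by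
  obtain ⟨w, rfl⟩ := hz
  refine (coord_map_param _ w).trans ((pairR_map_prod w).symm.trans ?_)
  rw [← c.coord_map_param, ← c'.coord_map_param]
  exact congrArg₂ (fun x y => pairR (c.coord x) (c'.coord y)) (Ext.fst_prod_param c c' w).symm
    (Ext.snd_prod_param c c' w).symm

/-- Equality in `•(M × N)` involves all observables of the product, not only those pulled back from
the factors. A product chart reduces it to equality of paired coordinates. -/
lemma Ext.prod_injective {z z' : Ext (M.prod N).toCSpace}
    (h₁ : Ext.map (M.fst N) z = Ext.map (M.fst N) z')
    (h₂ : Ext.map (M.snd N) z = Ext.map (M.snd N) z') : z = z' := by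
  obtain ⟨c, hc⟩ := CChart.exists_mem_dom M.locEuclidean (Ext.map (M.fst N) z)
  obtain ⟨c', hc'⟩ := CChart.exists_mem_dom N.locEuclidean (Ext.map (M.snd N) z)
  have hz := c.mem_dom_prod c' hc hc'
  have hz' := c.mem_dom_prod c' (h₁ ▸ hc) (h₂ ▸ hc')
  exact (c.prod c').coord_injOn hz hz' (by rw [c.coord_prod c' hz, c.coord_prod c' hz', h₁, h₂])

/-- Both points are lifted to parameter paths in charts, and the two paths are juxtaposed. -/
lemma Ext.exists_prod (x : Ext M.toCSpace) (y : Ext N.toCSpace) :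
    ∃ z : Ext (M.prod N).toCSpace, Ext.map (M.fst N) z = x ∧ Ext.map (M.snd N) z = y := by
  obtain ⟨c, w, rfl⟩ := CChart.exists_mem_dom M.locEuclidean x
  obtain ⟨c', w', rfl⟩ := CChart.exists_mem_dom N.locEuclidean y
  obtain ⟨v, rfl, rfl⟩ := exists_mkW_prod w w'
  exact ⟨_, Ext.fst_prod_param c c' v, Ext.snd_prod_param c c' v⟩

/-- The extension of an arrow of `Cⁿ`, as an arrow of extended spaces. -/
def Ext.mapHom {X Y : CSpace.{u} n} (f : X.Hom Y) : (extSpace X).Hom (extSpace Y) :=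
  ⟨fun z => (Ext.map f z.1).toSpace, fun H δ hδ => by
    refine (extSpace Y).fig_sheaf H _ fun x₀ => ?_
    obtain ⟨U, hx₀, hU⟩ := extSpace_fig_local hδ x₀
    refine ⟨U, hx₀, ?_⟩
    rcases hU with ⟨z, hz⟩ | ⟨m, V, h, g, hg, hU⟩
    · refine (congrArg ((extSpace Y).fig _) (funext fun x => ?_)).mp
        ((extSpace Y).fig_const _ (Ext.map f z).toSpace)
      exact congrArg (fun z => (Ext.map f z).toSpace) (hz x).symm
    · refine extSpace_fig_of_sMor (f.comp h) hg fun x => ?_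
      obtain ⟨y, hy, e⟩ := hU x
      exact ⟨y, hy, (congrArg (Ext.map f) e).trans (Ext.map_comp f h y).symm⟩⟩

/-- With the bijectivity above, this makes `•(M × N)` the product of `•M` and `•N` as extended
spaces: locally the coordinates of `δ` are the pairing of those of its components. -/
lemma Man.ext_prod_fig {H : SERObj n} {δ : H.2 → (M.prod N).ext.carrier}
    (h₁ : M.ext.fig H fun x => (Ext.map (M.fst N) (δ x).1).toSpace)
    (h₂ : N.ext.fig H fun x => (Ext.map (M.snd N) (δ x).1).toSpace) : (M.prod N).ext.fig H δ := by
  refine (M.prod N).ext.fig_sheaf H _ fun x₀ => ?_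
  obtain ⟨c, hc⟩ := CChart.exists_mem_dom M.locEuclidean (Ext.map (M.fst N) (δ x₀).1)
  obtain ⟨c', hc'⟩ := CChart.exists_mem_dom N.locEuclidean (Ext.map (M.snd N) (δ x₀).1)
  let U : TopologicalSpace.Opens H.2 :=
    ⟨_, (c.isOpen_preimage_dom h₁).inter (c'.isOpen_preimage_dom h₂)⟩
  have hmem : ∀ x, inclS H U x ∈ U := fun x => by
    have : inclS H U x ∈ (U : Set H.2) := by rw [← range_inclS]; exact ⟨x, rfl⟩
    exact this
  refine ⟨U, ⟨hc, hc'⟩, ?_⟩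
  have hdom : ∀ x, (δ (inclS H U x)).1 ∈ (c.prod c').dom := fun x =>
    c.mem_dom_prod c' (hmem x).1 (hmem x).2
  refine (c.prod c').fig_of_sMor_coord hdom ?_
  refine (congrArg SMor (funext fun x => ?_)).mp
    ((c.sMor_coord (M.ext.fig_comp ((SER n).isMor_incl H U) h₁) fun x => (hmem x).1).pairR
      (c'.sMor_coord (N.ext.fig_comp ((SER n).isMor_incl H U) h₂) fun x => (hmem x).2))
  exact (c.coord_prod c' (hdom x)).symm

/-- The pairing `•M × •N → •(M × N)`. -/
noncomputable def Man.pairExt (x : M.ext.carrier) (y : N.ext.carrier) : (M.prod N).ext.carrier :=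
  (Ext.exists_prod x.1 y.1).choose.toSpace

lemma Man.fst_pairExt (x : M.ext.carrier) (y : N.ext.carrier) :
    (Ext.map (M.fst N) (Man.pairExt x y).1).toSpace = x :=
  Subtype.ext (Ext.exists_prod x.1 y.1).choose_spec.1

lemma Man.snd_pairExt (x : M.ext.carrier) (y : N.ext.carrier) :
    (Ext.map (M.snd N) (Man.pairExt x y).1).toSpace = y :=
  Subtype.ext (Ext.exists_prod x.1 y.1).choose_spec.2

lemma Man.pairExt_eta (z : (M.prod N).ext.carrier) :
    Man.pairExt (Ext.map (M.fst N) z.1).toSpace (Ext.map (M.snd N) z.1).toSpace = z :=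
  Subtype.ext (Ext.prod_injective (congrArg Subtype.val (Man.fst_pairExt _ _))
    (congrArg Subtype.val (Man.snd_pairExt _ _)))

lemma Man.fig_pairExt {H : (SER n).Obj} {d : (SER n).carrier H → M.ext.carrier}
    {e : (SER n).carrier H → N.ext.carrier} (hd : M.ext.fig H d) (he : N.ext.fig H e) :
    (M.prod N).ext.fig H fun h => Man.pairExt (d h) (e h) :=
  Man.ext_prod_fig (by simpa only [Man.fst_pairExt] using hd)
    (by simpa only [Man.snd_pairExt] using he)

/-- The isomorphism `(X^•M)^•N ≅ X^•(M × N)`. -/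
noncomputable def expProdIso (M N : Man.{u} n) (X : ECSpace.{u} n) :
    (N.ext.exp (M.ext.exp X)).Iso ((M.prod N).ext.exp X) where
  hom := Space.curry ⟨fun z => (z.1.1 (Ext.mapHom (M.snd N) z.2)).1 (Ext.mapHom (M.fst N) z.2),
    fun _ d hd => Space.fig_eval (Space.fig_eval hd.1 ((Ext.mapHom (M.snd N)).2 _ _ hd.2))
      ((Ext.mapHom (M.fst N)).2 _ _ hd.2)⟩
  -- The outer exponent is `•N`, so currying twice supplies the point of `•N` as `z.1.2` and the
  -- point of `•M` as `z.2`.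
  inv := Space.curry (Space.curry ⟨fun z => z.1.1.1 (Man.pairExt z.2 z.1.2),
    fun _ d hd => Space.fig_eval hd.1.1 (Man.fig_pairExt hd.2 hd.1.2)⟩)
  hom_inv f := Subtype.ext (funext fun z => congrArg f.1 (Man.pairExt_eta z))
  inv_hom f := Subtype.ext (funext fun y => Subtype.ext (funext fun x => by
    show (f.1 (Ext.map (M.snd N) (Man.pairExt x y).1).toSpace).1
      (Ext.map (M.fst N) (Man.pairExt x y).1).toSpace = _
    rw [Man.fst_pairExt, Man.snd_pairExt]))

end Prod

/-! ### Iterated exponentials -/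

variable [Fact (1 ≤ n)]

/-- Composition of isomorphisms. -/
def Space.Iso.trans {F : FigCat} {X Y Z : Space F} (φ : X.Iso Y) (ψ : Y.Iso Z) : X.Iso Z where
  hom := ψ.hom.comp φ.hom
  inv := φ.inv.comp ψ.inv
  hom_inv z := (congrArg ψ.hom.1 (φ.hom_inv _)).trans (ψ.hom_inv z)
  inv_hom x := (congrArg φ.inv.1 (ψ.inv_hom _)).trans (φ.inv_hom x)

/-- The base `X` is generalized in the induction: the innermost exponent `•M` is absorbed into it,
the induction hypothesis treats the base `X^•M`, and `expProdIso` then moves `•M` into the product.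
-/
lemma exists_iso_iterExp (L : List (Man.{u} n)) : ∀ (X : ECSpace.{u} n) (M : Man.{u} n),
    ∃ Φ : (iterExp X (M :: L)).Iso ((M.listProd L).ext.exp X),
      ∀ (F : (iterExp X (M :: L)).carrier) (z : Ext (M.listProd L).toCSpace),
        (Φ.hom F).1 z.toSpace = evalIter X M L F z := by
  induction L with
  | nil =>
    intro X M
    exact ⟨⟨⟨fun f => f, fun _ _ hd => hd⟩, ⟨fun f => f, fun _ _ hd => hd⟩, fun _ => rfl,
      fun _ => rfl⟩, fun _ _ => rfl⟩
  | cons N L ih =>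
    intro X M
    obtain ⟨Φ, hΦ⟩ := ih (M.ext.exp X) N
    refine ⟨Φ.trans (expProdIso M (N.listProd L) X), fun F z => ?_⟩
    exact congrArg (fun g : M.ext.Hom X => g.1 (Ext.map (M.fst (N.listProd L)) z).toSpace)
      (hΦ F (Ext.map (M.snd (N.listProd L)) z))

end

end IDG
open IDG in
theorem mainTheorem3 (n : ℕ∞) [Fact (1 ≤ n)] :
    (∀ M : Man.{u} n, InfLinear M.ext) ∧
    ∀ (M₁ M₂ : Man.{u} n) (L : List (Man.{u} n)),
      (∃ Φ : (iterExp M₁.ext (M₂ :: L)).Iso ((M₂.listProd L).ext.exp M₁.ext),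
        ∀ (F : (iterExp M₁.ext (M₂ :: L)).carrier) (z : Ext (M₂.listProd L).toCSpace),
          (Φ.hom F).1 z.toSpace = evalIter M₁.ext M₂ L F z) ∧
      InfLinear (iterExp M₁.ext (M₂ :: L)) ∧
      InfLinear ((M₂.listProd L).ext.exp M₁.ext) := by
  refine ⟨fun M => infLinear_extSpace M.locEuclidean, fun M₁ M₂ L => ?_⟩
  obtain ⟨Φ, hΦ⟩ := exists_iso_iterExp L M₁.ext M₂
  have h : InfLinear ((M₂.listProd L).ext.exp M₁.ext) := infLinear_exp M₁.locEuclidean _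
  exact ⟨⟨Φ, hΦ⟩, h.of_iso Φ, h⟩
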